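/- All maps are continuous. Let $(S,\le)$ be a directed set and $(Z_s,z_s)_{s\in S}$ pointed spaces. Their *directed wedge* is the wedge $Z$ obtained from the disjoint union by identifying all $z_s$ to one point $z_0$, where $U\subset Z$ is open if and only if $U\cap Z_s$ is open in $Z_s$ for all $s$ and, in case $z_0\in U$, there is $t\in S$ with $Z_s\subset U$ for all $s>t$. A *disk-hedgehog* is a directed wedge in which every $Z_s$ is homeomorphic to the closed $2$-disk. A *disk-hedgehog covering* is a map $p:E\to B$ such that for every disk-hedgehog $H$, every $x_0\in H$, $e_0\in E$ and every map $f:H\to B$ with $f(x_0)=p(e_0)$ there is exactly one map $g:H\to E$ with $p\circ g=f$ and $g(x_0)=e_0$. Such a $p$ also has existence and uniqueness of lifts of paths. A space is a *Peano space* if it is connected and locally path-connected. For disk-hedgehog coverings $p_1:E_1\to B$, $p_2:E_2\to B$ with $E_1,E_2$ Peano, $p_1\ge p_2$ means that for all $e_1\in E_1$, $e_2\in E_2$ with $p_1(e_1)=p_2(e_2)$ there is a map $f:E_1\to E_2$ with $p_2\circ f=p_1$ and $f(e_1)=e_2$. Every path-connected space $B$ has a maximal disk-hedgehog covering, that is,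 one with Peano total space that is $\ge$ every disk-hedgehog covering of $B$ with Peano total space; it is unique up to equivalence of coverings. For a path-connected space $B$ and $b_0\in B$, the *hedgehog fundamental group* $\pi(B,b_0)$ is the monodromy group at $b_0$ of the maximal disk-hedgehog covering $p:E\to B$: the set of loops in $B$ at $b_0$ modulo the relation that $\alpha\sim\beta$ if and only if any lift of $\alpha$ and any lift of $\beta$ to $E$ with the same initial point have the same end-point, with the group operation induced by concatenation. **Corollary.** Let $B$ be a Peano continuum, that is, a compact metrizable space that is connected and locally path-connected, and let $b_0\in B$. If $\pi(B,b_0)$ is countable, then $\pi(B,b_0)$ is finitely presented. -/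

import Mathlib

open Set Topology unitInterval

namespace Hedgehog

universe u v

/-! ### Directed wedges and disk-hedgehogs -/

section Wedge

variable {S : Type u} (Z : S → Type v) (z : ∀ s, Z s)

/-- The relation on the disjoint union of the `Z s` that identifies all base points `z s`. -/
def wedgeSetoid : Setoid (Σ s, Z s) where
  r a b := a = b ∨ (a.2 = z a.1 ∧ b.2 = z b.1)
  iseqv :=
    { refl := fun _ => Or.inl rfl
      symm := by
        rintro a b (h | h)
        · exact Or.inl h.symm
        · exact Or.inr ⟨h.2, h.1⟩
      trans := by
        rintro a b c (rfl | h) (rfl | h')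
        · exact Or.inl rfl
        · exact Or.inr h'
        · exact Or.inr h
        · exact Or.inr ⟨h.1, h'.2⟩ }

/-- The underlying set of the wedge of the pointed spaces `(Z s, z s)`. -/
def DirectedWedge : Type (max u v) := Quotient (wedgeSetoid Z z)

namespace DirectedWedge

variable {Z}

/-- The inclusion of `Z s` into the wedge. -/
def incl (s : S) (x : Z s) : DirectedWedge Z z := Quotient.mk (wedgeSetoid Z z) ⟨s, x⟩

variable {z}

theorem incl_base (s t : S) : incl z s (z s) = incl z t (z t) :=
  Quotient.sound (Or.inr ⟨rfl, rfl⟩)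

/-- The topology of the directed wedge: a set `U` is open if all its traces on the `Z s` are open
and, in case `U` contains the base point, `U` contains `Z s` for all `s > t`, for some `t`. -/
instance [Preorder S] [IsDirectedOrder S] [Nonempty S] [∀ s, TopologicalSpace (Z s)] :
    TopologicalSpace (DirectedWedge Z z) where
  IsOpen U := (∀ s, IsOpen (incl z s ⁻¹' U)) ∧
    ((∃ s, incl z s (z s) ∈ U) → ∃ t, ∀ s, t < s → ∀ x, incl z s x ∈ U)
  isOpen_univ := ⟨fun _ => isOpen_univ, fun _ => ⟨Classical.arbitrary S, fun _ _ _ => trivial⟩⟩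
  isOpen_inter := by
    rintro U V ⟨hU, hU'⟩ ⟨hV, hV'⟩
    refine ⟨fun s => (hU s).inter (hV s), ?_⟩
    rintro ⟨s, hs⟩
    obtain ⟨t, ht⟩ := hU' ⟨s, hs.1⟩
    obtain ⟨t', ht'⟩ := hV' ⟨s, hs.2⟩
    obtain ⟨r, hr, hr'⟩ := exists_ge_ge t t'
    exact ⟨r, fun s hs x => ⟨ht s (hr.trans_lt hs) x, ht' s (hr'.trans_lt hs) x⟩⟩
  isOpen_sUnion := by
    intro A hA
    refine ⟨fun s => ?_, ?_⟩
    · rw [preimage_sUnion]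
      exact isOpen_biUnion fun U hU => (hA U hU).1 s
    · rintro ⟨s, U, hU, hs⟩
      obtain ⟨t, ht⟩ := (hA U hU).2 ⟨s, hs⟩
      exact ⟨t, fun s hs x => ⟨U, hU, ht s hs x⟩⟩

theorem isOpen_iff [Preorder S] [IsDirectedOrder S] [Nonempty S] [∀ s, TopologicalSpace (Z s)]
    {U : Set (DirectedWedge Z z)} :
    IsOpen U ↔ (∀ s, IsOpen (incl z s ⁻¹' U)) ∧
      ((∃ s, incl z s (z s) ∈ U) → ∃ t, ∀ s, t < s → ∀ x, incl z s x ∈ U) := Iff.rfl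

theorem continuous_incl [Preorder S] [IsDirectedOrder S] [Nonempty S]
    [∀ s, TopologicalSpace (Z s)] (s : S) : Continuous (incl z s) :=
  ⟨fun _ hU => (isOpen_iff.1 hU).1 s⟩

/-- The map out of a wedge given by maps on the `Z s` that agree at the base points. -/
def desc {Y : Type*} (f : ∀ s, Z s → Y) (h : ∀ s t, f s (z s) = f t (z t)) :
    DirectedWedge Z z → Y :=
  Quotient.lift (fun a : Σ s, Z s => f a.1 a.2) (by
    rintro a b (rfl | ⟨ha, hb⟩)
    · rfl
    · show f a.1 a.2 = f b.1 b.2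
      rw [ha, hb, h])

@[simp] theorem desc_incl {Y : Type*} (f : ∀ s, Z s → Y) (h : ∀ s t, f s (z s) = f t (z t))
    (s : S) (x : Z s) : desc (z := z) f h (incl z s x) = f s x := rfl

theorem exists_incl (w : DirectedWedge Z z) : ∃ s x, w = incl z s x := by
  induction w using Quotient.inductionOn with
  | h a => exact ⟨a.1, a.2, rfl⟩

variable [Preorder S] [IsDirectedOrder S] [Nonempty S] [∀ s, TopologicalSpace (Z s)]

theorem pathConnectedSpace [∀ s, PathConnectedSpace (Z s)] :
    PathConnectedSpace (DirectedWedge Z z) := by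
  let s₀ : S := Classical.arbitrary S
  have key : ∀ w : DirectedWedge Z z, Joined (incl z s₀ (z s₀)) w := by
    intro w
    obtain ⟨s, x, rfl⟩ := exists_incl w
    rw [incl_base s₀ s]
    exact (PathConnectedSpace.joined (z s) x).map (continuous_incl s)
  exact ⟨⟨incl z s₀ (z s₀)⟩, fun x y => (key x).symm.trans (key y)⟩

theorem locallyPathConnectedSpace [∀ s, PathConnectedSpace (Z s)]
    [∀ s, LocallyPathConnectedSpace (Z s)] :
    LocallyPathConnectedSpace (DirectedWedge Z z) := by
  rw [locallyPathConnectedSpace_iff_isOpen_pathComponentIn]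
  intro w U hU
  obtain ⟨hU₁, hU₂⟩ := isOpen_iff.1 hU
  refine isOpen_iff.2 ⟨fun s => ?_, ?_⟩
  · rw [isOpen_iff_mem_nhds]
    intro x hx
    have hxU : incl z s x ∈ U := pathComponentIn_subset hx
    refine Filter.mem_of_superset (pathComponentIn_mem_nhds ((hU₁ s).mem_nhds hxU)) ?_
    intro y hy
    have h : JoinedIn (incl z s ⁻¹' U) x y := hy
    have h' : JoinedIn U (incl z s x) (incl z s y) :=
      (h.map (continuous_incl s)).mono (image_preimage_subset _ _)
    exact JoinedIn.trans hx h'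
  · rintro ⟨s₁, hs₁⟩
    obtain ⟨t, ht⟩ := hU₂ ⟨s₁, pathComponentIn_subset hs₁⟩
    refine ⟨t, fun s hs x => ?_⟩
    have h : JoinedIn U (incl z s (z s)) (incl z s x) := by
      refine ⟨(PathConnectedSpace.somePath (z s) x).map (continuous_incl s), fun r => ?_⟩
      exact ht s hs _
    rw [incl_base s s₁] at h
    exact JoinedIn.trans hs₁ h

end DirectedWedge

end Wedge

/-- The unit disk in the plane. -/
abbrev Disk : Type := Metric.closedBall (0 : EuclideanSpace ℝ (Fin 2)) 1

/-- Disk-hedgehogs, up to homeomorphism: directed wedges of disks, the disk `s` being pointed at an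
arbitrary point `z s`. -/
abbrev DiskHedgehog {S : Type u} (z : S → Disk) : Type u := DirectedWedge (fun _ : S => Disk) z

/-! ### Coverings -/

section Coverings

variable {E B : Type*} [TopologicalSpace E] [TopologicalSpace B]

/-- `p` has existence and uniqueness of lifts of maps from the space `X`. -/
structure HasUniqueLifts (p : C(E, B)) (X : Type*) [TopologicalSpace X] : Prop where
  exists_lift : ∀ (e₀ : E) (x₀ : X) (f : C(X, B)), f x₀ = p e₀ →
    ∃ g : C(X, E), (∀ x, p (g x) = f x) ∧ g x₀ = e₀
  unique_lift : ∀ g h : C(X, E), (∀ x, p (g x) = p (h x)) → ∀ x₀, g x₀ = h x₀ → g = h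

/-- Arc-coverings. -/
def IsArcCovering (p : C(E, B)) : Prop := HasUniqueLifts p I

/-- `LiftsTo p α e e'` says that the path `α` in `B` has a lift to `E` from `e` to `e'`. -/
def LiftsTo (p : C(E, B)) {b b' : B} (α : Path b b') (e e' : E) : Prop :=
  ∃ γ : Path e e', ∀ t, p (γ t) = α t

theorem HasUniqueLifts.of_retract {p : C(E, B)} {X Y : Type*} [TopologicalSpace X]
    [TopologicalSpace Y] (i : C(Y, X)) (r : C(X, Y)) (hri : ∀ y, r (i y) = y)
    (h : HasUniqueLifts p X) : HasUniqueLifts p Y where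
  exists_lift e₀ y₀ f hf := by
    obtain ⟨g, hg, hg₀⟩ := h.exists_lift e₀ (i y₀) (f.comp r) (by simpa [hri] using hf)
    exact ⟨g.comp i, fun y => by simpa [hri] using hg (i y), hg₀⟩
  unique_lift g g' hgg y₀ h₀ := by
    have := h.unique_lift (g.comp r) (g'.comp r) (fun x => hgg (r x)) (i y₀) (by simpa [hri])
    ext y
    simpa [hri] using DFunLike.congr_fun this (i y)

namespace LiftsTo

variable {p : C(E, B)} {b b' b'' : B} {α : Path b b'} {β : Path b' b''} {e e' e'' : E}

theorem source (h : LiftsTo p α e e') : p e = b := by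
  obtain ⟨γ, hγ⟩ := h
  simpa using hγ 0

theorem target (h : LiftsTo p α e e') : p e' = b' := by
  obtain ⟨γ, hγ⟩ := h
  simpa using hγ 1

theorem refl (h : p e = b) : LiftsTo p (Path.refl b) e e := ⟨Path.refl e, fun _ => h⟩

theorem symm (h : LiftsTo p α e e') : LiftsTo p α.symm e' e := by
  obtain ⟨γ, hγ⟩ := h
  exact ⟨γ.symm, fun t => hγ _⟩

theorem trans (h : LiftsTo p α e e') (h' : LiftsTo p β e' e'') :
    LiftsTo p (α.trans β) e e'' := by
  obtain ⟨γ, hγ⟩ := h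
  obtain ⟨δ, hδ⟩ := h'
  refine ⟨γ.trans δ, fun t => ?_⟩
  rw [Path.trans_apply, Path.trans_apply]
  split_ifs
  · exact hγ _
  · exact hδ _

theorem exists_of_source (hp : IsArcCovering p) (α : Path b b') (h : p e = b) :
    ∃ e', LiftsTo p α e e' := by
  obtain ⟨g, hg, hg₀⟩ := hp.exists_lift e 0 α.toContinuousMap (by simpa using h.symm)
  exact ⟨g 1, ⟨⟨g, hg₀, rfl⟩, fun t => hg t⟩⟩

theorem unique (hp : IsArcCovering p) {e₁ e₂ : E} (h₁ : LiftsTo p α e e₁)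
    (h₂ : LiftsTo p α e e₂) : e₁ = e₂ := by
  obtain ⟨γ, hγ⟩ := h₁
  obtain ⟨δ, hδ⟩ := h₂
  have := hp.unique_lift γ.toContinuousMap δ.toContinuousMap
    (fun t => (hγ t).trans (hδ t).symm) 0 (by simp)
  simpa using DFunLike.congr_fun this 1

theorem trans_iff (hp : IsArcCovering p) :
    LiftsTo p (α.trans β) e e'' ↔ ∃ x, LiftsTo p α e x ∧ LiftsTo p β x e'' := by
  constructor
  · intro h
    obtain ⟨x, hx⟩ := exists_of_source hp α h.source
    obtain ⟨y, hy⟩ := exists_of_source hp β hx.target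
    exact ⟨x, hx, (unique hp h (hx.trans hy)) ▸ hy⟩
  · rintro ⟨x, hx, hy⟩
    exact hx.trans hy

theorem symm_iff : LiftsTo p α.symm e' e ↔ LiftsTo p α e e' :=
  ⟨fun h => by simpa using h.symm, symm⟩

end LiftsTo

/-! ### The monodromy group -/

/-- Two loops at `b₀` are equivalent if any two of their lifts that start at the same point end
at the same point. -/
def monodromySetoid (p : C(E, B)) (hp : IsArcCovering p) (b₀ : B) : Setoid (Path b₀ b₀) where
  r α β := ∀ e e₁ e₂, LiftsTo p α e e₁ → LiftsTo p β e e₂ → e₁ = e₂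
  iseqv :=
    { refl := fun _ _ _ _ h₁ h₂ => h₁.unique hp h₂
      symm := fun h e e₁ e₂ h₁ h₂ => (h e e₂ e₁ h₂ h₁).symm
      trans := by
        intro α β γ h h' e e₁ e₂ h₁ h₂
        obtain ⟨x, hx⟩ := LiftsTo.exists_of_source hp β h₁.source
        exact (h e _ _ h₁ hx).trans (h' e _ _ hx h₂) }

/-- The monodromy group `π(p, b₀)`: equivalence classes of loops at `b₀`. -/
def MonodromyGroup (p : C(E, B)) (hp : IsArcCovering p) (b₀ : B) : Type _ :=
  Quotient (monodromySetoid p hp b₀)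

/-- The group operation is induced by concatenation, the inverse by reversal. -/
noncomputable instance (p : C(E, B)) (hp : IsArcCovering p) (b₀ : B) : Group (MonodromyGroup p hp b₀) :=
  letI : Mul (MonodromyGroup p hp b₀) := ⟨Quotient.map₂ (fun α β => α.trans β) (by
    intro α α' hα β β' hβ e e₁ e₂ h₁ h₂
    obtain ⟨x, hx, hx'⟩ := (LiftsTo.trans_iff hp).1 h₁
    obtain ⟨y, hy, hy'⟩ := (LiftsTo.trans_iff hp).1 h₂
    obtain rfl := hα e x y hx hy
    exact hβ x _ _ hx' hy')⟩
  letI : Inv (MonodromyGroup p hp b₀) := ⟨Quotient.map (fun α => α.symm) (by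
    intro α α' hα e e₁ e₂ h₁ h₂
    have h₁' := LiftsTo.symm_iff.1 h₁
    obtain ⟨y, hy⟩ := LiftsTo.exists_of_source hp α' h₁'.source
    obtain rfl := hα e₁ e y h₁' hy
    exact hy.symm.unique hp h₂)⟩
  letI : One (MonodromyGroup p hp b₀) := ⟨Quotient.mk _ (Path.refl b₀)⟩
  Group.ofLeftAxioms
    (by
      intro a b c
      induction a, b, c using Quotient.inductionOn₃ with
      | h α β γ =>
        refine Quotient.sound ?_
        intro e e₁ e₂ h₁ h₂
        obtain ⟨x, hx, hx'⟩ := (LiftsTo.trans_iff hp).1 h₁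
        obtain ⟨y, hy, hy'⟩ := (LiftsTo.trans_iff hp).1 hx
        exact (hy.trans (hy'.trans hx')).unique hp h₂)
    (by
      intro a
      induction a using Quotient.inductionOn with
      | h α =>
        refine Quotient.sound ?_
        intro e e₁ e₂ h₁ h₂
        exact h₁.unique hp ((LiftsTo.refl h₂.source).trans h₂))
    (by
      intro a
      induction a using Quotient.inductionOn with
      | h α =>
        refine Quotient.sound ?_
        intro e e₁ e₂ h₁ h₂
        obtain ⟨x, hx, hx'⟩ := (LiftsTo.trans_iff hp).1 h₁
        rw [((LiftsTo.refl h₂.source).unique hp h₂).symm]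
        exact hx'.unique hp (LiftsTo.symm_iff.1 hx))

end Coverings

/-! ### Disk-hedgehog coverings -/

section DiskHedgehogCoverings

variable {E B : Type u} [TopologicalSpace E] [TopologicalSpace B]

/-- Disk-hedgehog coverings: maps with existence and uniqueness of lifts of all maps from
disk-hedgehogs. -/
def IsDiskHedgehogCovering (p : C(E, B)) : Prop :=
  ∀ (S : Type u) [Preorder S] [IsDirectedOrder S] [Nonempty S] (z : S → Disk),
    HasUniqueLifts p (DiskHedgehog z)

/-- The inequality `p ≥ q` of unpointed coverings of `B`. -/
def CoveringGE {E₁ E₂ : Type u} [TopologicalSpace E₁] [TopologicalSpace E₂]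
    (p : C(E₁, B)) (q : C(E₂, B)) : Prop :=
  ∀ e₁ e₂, p e₁ = q e₂ → ∃ f : C(E₁, E₂), (∀ x, q (f x) = p x) ∧ f e₁ = e₂

/-- `p` is the maximal disk-hedgehog covering of `B` among those whose total space is a Peano
space, that is, connected and locally path-connected. -/
structure IsMaximalDiskHedgehogCovering (p : C(E, B)) : Prop where
  connectedSpace : ConnectedSpace E
  locallyPathConnectedSpace : LocallyPathConnectedSpace E
  isDiskHedgehogCovering : IsDiskHedgehogCovering p
  coveringGE : ∀ (E' : Type u) [TopologicalSpace E'] [ConnectedSpace E']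
    [LocallyPathConnectedSpace E'] (q : C(E', B)), IsDiskHedgehogCovering q → CoveringGE p q

instance : PathConnectedSpace Disk :=
  isPathConnected_iff_pathConnectedSpace.1
    ((convex_closedBall _ _).isPathConnected ⟨0, by simp⟩)

instance : LocallyPathConnectedSpace Disk := (convex_closedBall _ _).locallyPathConnectedSpace

/-- The norm, as a retraction of the disk onto an arc. -/
noncomputable def diskToArc : C(Disk, I) where
  toFun x := ⟨‖(x : EuclideanSpace ℝ (Fin 2))‖, norm_nonneg _, mem_closedBall_zero_iff.1 x.2⟩
  continuous_toFun := by fun_prop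

/-- A radius of the disk. -/
noncomputable def arcToDisk : C(I, Disk) where
  toFun t := ⟨(t : ℝ) • EuclideanSpace.single 0 1, by
    simpa [norm_smul, abs_of_nonneg t.2.1] using t.2.2⟩
  continuous_toFun := by fun_prop

theorem diskToArc_arcToDisk (t : I) : diskToArc (arcToDisk t) = t := by
  ext
  simp [diskToArc, arcToDisk, norm_smul, abs_of_nonneg t.2.1]

theorem diskToArc_center : diskToArc (arcToDisk 0) = 0 := diskToArc_arcToDisk 0

theorem IsDiskHedgehogCovering.isArcCovering {p : C(E, B)} (hp : IsDiskHedgehogCovering p) :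
    IsArcCovering p := by
  refine HasUniqueLifts.of_retract
    (X := DiskHedgehog (fun _ : PUnit.{u + 1} => arcToDisk 0))
    ⟨fun t => DirectedWedge.incl _ PUnit.unit (arcToDisk t),
      (DirectedWedge.continuous_incl _).comp arcToDisk.continuous⟩
    ⟨DirectedWedge.desc (fun _ => diskToArc) (fun _ _ => rfl), ⟨fun U hU => ?_⟩⟩
    (fun t => diskToArc_arcToDisk t) (hp _ _)
  refine DirectedWedge.isOpen_iff.2 ⟨fun s => hU.preimage diskToArc.continuous, fun _ => ?_⟩
  exact ⟨PUnit.unit, fun s hs => absurd hs (lt_irrefl _)⟩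

/-- Path-components of preimages of open sets form a basis of the total space. -/
theorem IsDiskHedgehogCovering.exists_isOpen {q : C(E, B)} (hq : IsDiskHedgehogCovering q)
    {b : B} {x : E} (hx : q x = b) {W : Set E} (hW : IsOpen W) (hxW : x ∈ W) :
    ∃ U : Set B, IsOpen U ∧ b ∈ U ∧ ∀ (b' : B) (γ : Path b b'), (∀ t, γ t ∈ U) →
      ∀ x', LiftsTo q γ x x' → x' ∈ W := by
  by_contra! hcon
  let S := {U : Set B // IsOpen U ∧ b ∈ U}ᵒᵈ × ℕ
  have : IsDirectedOrder {U : Set B // IsOpen U ∧ b ∈ U}ᵒᵈ := ⟨fun U V =>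
    ⟨OrderDual.toDual ⟨(OrderDual.ofDual U).1 ∩ (OrderDual.ofDual V).1,
        (OrderDual.ofDual U).2.1.inter (OrderDual.ofDual V).2.1,
        (OrderDual.ofDual U).2.2, (OrderDual.ofDual V).2.2⟩,
      fun _ h => h.1, fun _ h => h.2⟩⟩
  have : IsDirectedOrder S := ⟨fun s t => by
    obtain ⟨U, hU, hU'⟩ := exists_ge_ge s.1 t.1
    obtain ⟨n, hn, hn'⟩ := exists_ge_ge s.2 t.2
    exact ⟨(U, n), ⟨hU, hn⟩, ⟨hU', hn'⟩⟩⟩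
  have : Nonempty S := ⟨(OrderDual.toDual ⟨univ, isOpen_univ, trivial⟩, 0)⟩
  have hcon' : ∀ s : S, ∃ (b' : B) (γ : Path b b'), (∀ t, γ t ∈ (OrderDual.ofDual s.1).1) ∧
      ∃ x', LiftsTo q γ x x' ∧ x' ∉ W := fun s => by
    exact hcon _ (OrderDual.ofDual s.1).2.1 (OrderDual.ofDual s.1).2.2
  choose b' γ hγ x' hx' hx'W using hcon'
  let z : S → Disk := fun _ => arcToDisk 0
  let f : C(DiskHedgehog z, B) :=
    ⟨DirectedWedge.desc (fun s v => γ s (diskToArc v)) (fun s t => by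
      simp [z, diskToArc_center]), ⟨fun V hV => by
      refine DirectedWedge.isOpen_iff.2 ⟨fun s => ?_, ?_⟩
      · exact hV.preimage ((γ s).continuous.comp diskToArc.continuous)
      · rintro ⟨s, hs⟩
        have hbV : b ∈ V := by simpa [z, diskToArc_center] using hs
        refine ⟨(OrderDual.toDual ⟨V, hV, hbV⟩, 0), fun s hs v => ?_⟩
        exact hs.le.1 (hγ s _)⟩⟩
  let s₀ : S := Classical.arbitrary S
  obtain ⟨F, hF, hF₀⟩ := (hq S z).exists_lift x (DirectedWedge.incl z s₀ (z s₀)) f (by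
    simp [f, z, diskToArc_center, hx])
  obtain ⟨t, ht⟩ := (DirectedWedge.isOpen_iff.1 (hW.preimage F.continuous)).2
    ⟨s₀, by simpa [hF₀] using hxW⟩
  let s : S := (t.1, t.2 + 1)
  have hts : t < s := Prod.mk_lt_mk_iff_right.2 (Nat.lt_succ_self _)
  let G : C(I, E) := F.comp ⟨fun r => DirectedWedge.incl z s (arcToDisk r),
    (DirectedWedge.continuous_incl _).comp arcToDisk.continuous⟩
  have hG₀ : G 0 = x := by
    rw [← hF₀, DirectedWedge.incl_base s₀ s]
    rfl
  have hG : LiftsTo q (γ s) x (G 1) := ⟨⟨G, hG₀, rfl⟩, fun r => by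
    refine (hF _).trans ?_
    simp [f, diskToArc_arcToDisk]⟩
  exact hx'W s ((hx' s).unique hq.isArcCovering hG ▸ ht s hts _)

end DiskHedgehogCoverings

/-! ### Existence of the maximal disk-hedgehog covering -/

section Existence

variable {B : Type u} [TopologicalSpace B] (b₀ : B)

/-- Two paths from `b₀` are identified if they have the same end-point and if their lifts to any
disk-hedgehog covering by a Peano space that start at the same point end at the same point. -/
def pathClassSetoid : Setoid (Σ b : B, Path b₀ b) where
  r α β := α.1 = β.1 ∧ ∀ (E : Type u) [TopologicalSpace E] [ConnectedSpace E]
    [LocallyPathConnectedSpace E] (q : C(E, B)), IsDiskHedgehogCovering q →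
    ∀ e e₁ e₂, LiftsTo q α.2 e e₁ → LiftsTo q β.2 e e₂ → e₁ = e₂
  iseqv :=
    { refl := fun _ => ⟨rfl, fun _ _ _ _ _ hq _ _ _ h₁ h₂ => h₁.unique hq.isArcCovering h₂⟩
      symm := fun h => ⟨h.1.symm, fun E _ _ _ q hq e e₁ e₂ h₁ h₂ =>
        (h.2 E q hq e e₂ e₁ h₂ h₁).symm⟩
      trans := by
        intro α β γ h h'
        refine ⟨h.1.trans h'.1, fun E _ _ _ q hq e e₁ e₂ h₁ h₂ => ?_⟩
        obtain ⟨x, hx⟩ := LiftsTo.exists_of_source hq.isArcCovering β.2 h₁.source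
        exact (h.2 E q hq e _ _ h₁ hx).trans (h'.2 E q hq e _ _ hx h₂) }

/-- The space of classes of paths from `b₀`. -/
def PathClasses : Type u := Quotient (pathClassSetoid b₀)

namespace PathClasses

variable {b₀}

/-- The class of a path. -/
def mk {b : B} (α : Path b₀ b) : PathClasses b₀ := Quotient.mk (pathClassSetoid b₀) ⟨b, α⟩

theorem exists_mk (w : PathClasses b₀) : ∃ (b : B) (α : Path b₀ b), w = mk α := by
  induction w using Quotient.inductionOn with
  | h a => exact ⟨a.1, a.2, rfl⟩

theorem mk_eq {b : B} {α β : Path b₀ b}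
    (h : ∀ (E : Type u) [TopologicalSpace E] [ConnectedSpace E]
      [LocallyPathConnectedSpace E] (q : C(E, B)), IsDiskHedgehogCovering q →
      ∀ e e₁ e₂, LiftsTo q α e e₁ → LiftsTo q β e e₂ → e₁ = e₂) : mk α = mk β :=
  Quotient.sound ⟨rfl, h⟩

theorem mk_trans_congr {b b' : B} {α β : Path b₀ b} (h : mk α = mk β) (γ : Path b b') :
    mk (α.trans γ) = mk (β.trans γ) := by
  refine mk_eq fun E _ _ _ q hq e e₁ e₂ h₁ h₂ => ?_
  obtain ⟨x, hx, hx'⟩ := (LiftsTo.trans_iff hq.isArcCovering).1 h₁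
  obtain ⟨y, hy, hy'⟩ := (LiftsTo.trans_iff hq.isArcCovering).1 h₂
  obtain rfl := (Quotient.exact h).2 E q hq e x y hx hy
  exact hx'.unique hq.isArcCovering hy'

theorem mk_trans_assoc {b b' b'' : B} (α : Path b₀ b) (β : Path b b') (γ : Path b' b'') :
    mk ((α.trans β).trans γ) = mk (α.trans (β.trans γ)) := by
  refine mk_eq fun E _ _ _ q hq e e₁ e₂ h₁ h₂ => ?_
  obtain ⟨x, hx, hx'⟩ := (LiftsTo.trans_iff hq.isArcCovering).1 h₁
  obtain ⟨y, hy, hy'⟩ := (LiftsTo.trans_iff hq.isArcCovering).1 hx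
  exact (hy.trans (hy'.trans hx')).unique hq.isArcCovering h₂

variable (b₀) in
/-- The whisker topology. -/
instance : TopologicalSpace (PathClasses b₀) where
  IsOpen W := ∀ (b : B) (α : Path b₀ b), mk α ∈ W → ∃ U : Set B, IsOpen U ∧ b ∈ U ∧
    ∀ (b' : B) (γ : Path b b'), (∀ t, γ t ∈ U) → mk (α.trans γ) ∈ W
  isOpen_univ := fun _ _ _ => ⟨univ, isOpen_univ, trivial, fun _ _ _ => trivial⟩
  isOpen_inter := by
    intro V W hV hW b α hα
    obtain ⟨U, hU, hbU, h⟩ := hV b α hα.1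
    obtain ⟨U', hU', hbU', h'⟩ := hW b α hα.2
    exact ⟨U ∩ U', hU.inter hU', ⟨hbU, hbU'⟩, fun b' γ hγ =>
      ⟨h b' γ fun t => (hγ t).1, h' b' γ fun t => (hγ t).2⟩⟩
  isOpen_sUnion := by
    rintro A hA b α ⟨W, hW, hα⟩
    obtain ⟨U, hU, hbU, h⟩ := hA W hW b α hα
    exact ⟨U, hU, hbU, fun b' γ hγ => ⟨W, hW, h b' γ hγ⟩⟩

theorem isOpen_iff {W : Set (PathClasses b₀)} :
    IsOpen W ↔ ∀ (b : B) (α : Path b₀ b), mk α ∈ W → ∃ U : Set B, IsOpen U ∧ b ∈ U ∧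
      ∀ (b' : B) (γ : Path b b'), (∀ t, γ t ∈ U) → mk (α.trans γ) ∈ W := Iff.rfl

variable (b₀) in
/-- The end-point projection. -/
def proj : C(PathClasses b₀, B) where
  toFun := Quotient.lift (fun a : Σ b : B, Path b₀ b => a.1) fun _ _ h => h.1
  continuous_toFun := ⟨fun U hU => isOpen_iff.2 fun b α hα =>
    ⟨U, hU, hα, fun b' γ hγ => by
      have h := hγ 1
      rwa [γ.target] at h⟩⟩

@[simp] theorem proj_mk {b : B} (α : Path b₀ b) : proj b₀ (mk α) = b := rfl

theorem exists_mk_of_proj {w : PathClasses b₀} {b : B} (h : proj b₀ w = b) :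
    ∃ α : Path b₀ b, w = mk α := by
  obtain ⟨b', α, rfl⟩ := exists_mk w
  obtain rfl : b' = b := h
  exact ⟨α, rfl⟩

/-- Lifts to the space of path classes of maps that lift to all disk-hedgehog coverings. -/
theorem exists_lift {X : Type*} [TopologicalSpace X] [PathConnectedSpace X]
    [LocallyPathConnectedSpace X] (f : C(X, B)) (x₀ : X) {b : B} (hb : f x₀ = b)
    (α : Path b₀ b)
    (hX : ∀ (E : Type u) [TopologicalSpace E] [ConnectedSpace E]
      [LocallyPathConnectedSpace E] (q : C(E, B)), IsDiskHedgehogCovering q →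
      HasUniqueLifts q X) :
    ∃ g : C(X, PathClasses b₀), (∀ x, proj b₀ (g x) = f x) ∧ g x₀ = mk α ∧
      ∀ (x : X) (δ : Path x₀ x) (ε : Path b (f x)), (∀ t, ε t = f (δ t)) →
        g x = mk (α.trans ε) := by
  subst hb
  have key : ∀ (x : X) (δ δ' : Path x₀ x),
      mk (α.trans (δ.map f.continuous)) = mk (α.trans (δ'.map f.continuous)) := by
    intro x δ δ'
    refine mk_eq fun E _ _ _ q hq e e₁ e₂ h₁ h₂ => ?_
    obtain ⟨y, hy, hy₁⟩ := (LiftsTo.trans_iff hq.isArcCovering).1 h₁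
    obtain ⟨y', hy', hy₂⟩ := (LiftsTo.trans_iff hq.isArcCovering).1 h₂
    obtain rfl := hy.unique hq.isArcCovering hy'
    obtain ⟨F, hF, rfl⟩ := (hX E q hq).exists_lift y x₀ f hy.target.symm
    have h : ∀ ε : Path x₀ x, LiftsTo q (ε.map f.continuous) (F x₀) (F x) := fun ε =>
      ⟨ε.map F.continuous, fun t => hF _⟩
    exact (hy₁.unique hq.isArcCovering (h δ)).trans ((h δ').unique hq.isArcCovering hy₂)
  let g : X → PathClasses b₀ := fun x =>
    mk (α.trans ((PathConnectedSpace.somePath x₀ x).map f.continuous))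
  have hg : ∀ (x : X) (δ : Path x₀ x), g x = mk (α.trans (δ.map f.continuous)) :=
    fun x δ => key x _ _
  have hcont : Continuous g := by
    refine ⟨fun W hW => isOpen_iff_mem_nhds.2 fun x hx => ?_⟩
    obtain ⟨U, hU, hxU, h⟩ := isOpen_iff.1 hW _ _ hx
    refine Filter.mem_of_superset
      (pathComponentIn_mem_nhds ((hU.preimage f.continuous).mem_nhds hxU)) ?_
    rintro y ⟨ε, hε⟩
    have hy := h _ (ε.map f.continuous) hε
    rw [mk_trans_assoc, ← Path.map_trans, ← hg] at hy
    exact hy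
  refine ⟨⟨g, hcont⟩, fun x => rfl, ?_, fun x δ ε hε => ?_⟩
  · refine (hg x₀ (Path.refl x₀)).trans (mk_eq fun E _ _ _ q hq e e₁ e₂ h₁ h₂ => ?_)
    exact h₁.unique hq.isArcCovering (h₂.trans (LiftsTo.refl h₂.target))
  · have : ε = δ.map f.continuous := by
      ext t
      exact hε t
    rw [this]
    exact hg x δ

/-- If `W` contains the classes of all `α * ε` with `ε` in `U`, then these classes are joined
to the class of `α` in `W`. -/
theorem joinedIn {b b' : B} (α : Path b₀ b) (γ : Path b b') {U : Set B}
    {W : Set (PathClasses b₀)} (hγ : ∀ t, γ t ∈ U)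
    (hW : ∀ (c : B) (ε : Path b c), (∀ t, ε t ∈ U) → mk (α.trans ε) ∈ W) :
    JoinedIn W (mk α) (mk (α.trans γ)) := by
  have : PathConnectedSpace I :=
    isPathConnected_iff_pathConnectedSpace.1 ((convex_Icc (0 : ℝ) 1).isPathConnected ⟨0, by simp⟩)
  have : LocallyPathConnectedSpace I := (convex_Icc (0 : ℝ) 1).locallyPathConnectedSpace
  obtain ⟨g, -, hg₀, hg⟩ := exists_lift γ.toContinuousMap 0 γ.source α
    (fun E _ _ _ q hq => hq.isArcCovering)
  have hg₁ : g 1 = mk (α.trans γ) := by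
    have hc : ∀ (c : B) (hc : c = b'), mk (α.trans (γ.cast rfl hc)) = mk (α.trans γ) := by
      rintro c rfl
      rfl
    exact (hg 1 Path.id (γ.cast rfl γ.target) fun t => rfl).trans (hc _ γ.target)
  refine ⟨⟨g, hg₀, hg₁⟩, fun t => ?_⟩
  let δ : Path (0 : I) t := PathConnectedSpace.somePath 0 t
  have h := hg t δ ((δ.map γ.continuous).cast γ.source.symm rfl) fun _ => rfl
  refine (congrArg (· ∈ W) h).mpr (hW _ _ fun r => hγ _)

variable (b₀) in
theorem connectedSpace : ConnectedSpace (PathClasses b₀) := by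
  have key : ∀ w : PathClasses b₀, Joined (mk (Path.refl b₀)) w := by
    intro w
    obtain ⟨b, α, rfl⟩ := exists_mk w
    have h := (joinedIn (Path.refl b₀) α (U := univ) (W := univ) (fun _ => trivial)
      fun _ _ _ => trivial).joined
    have h' : mk ((Path.refl b₀).trans α) = mk α := mk_eq fun E _ _ _ q hq e e₁ e₂ h₁ h₂ =>
      h₁.unique hq.isArcCovering ((LiftsTo.refl h₂.source).trans h₂)
    rwa [h'] at h
  have : PathConnectedSpace (PathClasses b₀) :=
    ⟨⟨mk (Path.refl b₀)⟩, fun x y => (key x).symm.trans (key y)⟩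
  infer_instance

variable (b₀) in
theorem locallyPathConnectedSpace : LocallyPathConnectedSpace (PathClasses b₀) := by
  rw [locallyPathConnectedSpace_iff_isOpen_pathComponentIn]
  intro w W hW
  refine isOpen_iff.2 fun b α hα => ?_
  obtain ⟨U, hU, hbU, h⟩ := isOpen_iff.1 hW b α (pathComponentIn_subset hα)
  exact ⟨U, hU, hbU, fun b' γ hγ => JoinedIn.trans hα (joinedIn α γ hγ h)⟩

/-- The maps from the space of path classes to the disk-hedgehog coverings. -/
theorem exists_map {E : Type u} [TopologicalSpace E] [ConnectedSpace E]
    [LocallyPathConnectedSpace E] {q : C(E, B)} (hq : IsDiskHedgehogCovering q) {e : E}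
    (he : q e = b₀) :
    ∃ φ : C(PathClasses b₀, E), (∀ w, q (φ w) = proj b₀ w) ∧
      ∀ (b : B) (α : Path b₀ b), LiftsTo q α e (φ (mk α)) := by
  have h : ∀ a : Σ b : B, Path b₀ b, ∃ e', LiftsTo q a.2 e e' := fun a =>
    LiftsTo.exists_of_source hq.isArcCovering a.2 he
  choose ψ hψ using h
  let φ : PathClasses b₀ → E := Quotient.lift ψ fun a c hac =>
    hac.2 E q hq e _ _ (hψ a) (hψ c)
  have hφ : ∀ (b : B) (α : Path b₀ b), LiftsTo q α e (φ (mk α)) := fun b α => hψ ⟨b, α⟩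
  refine ⟨⟨φ, ⟨fun W hW => isOpen_iff.2 fun b α hα => ?_⟩⟩, fun w => ?_, hφ⟩
  · obtain ⟨U, hU, hbU, h⟩ := hq.exists_isOpen (hφ b α).target hW hα
    refine ⟨U, hU, hbU, fun b' γ hγ => h b' γ hγ _ ?_⟩
    obtain ⟨x, hx, hx'⟩ := (LiftsTo.trans_iff hq.isArcCovering).1 (hφ b' (α.trans γ))
    exact hx.unique hq.isArcCovering (hφ b α) ▸ hx'
  · obtain ⟨b, α, rfl⟩ := exists_mk w
    exact (hφ b α).target

variable (b₀) in
theorem isDiskHedgehogCovering : IsDiskHedgehogCovering (proj b₀) := by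
  intro S _ _ _ z
  have : PathConnectedSpace (DiskHedgehog z) := DirectedWedge.pathConnectedSpace
  have : LocallyPathConnectedSpace (DiskHedgehog z) := DirectedWedge.locallyPathConnectedSpace
  constructor
  · intro w x₀ f hf
    obtain ⟨α, rfl⟩ := exists_mk_of_proj hf.symm
    obtain ⟨g, hg, hg₀, -⟩ := exists_lift f x₀ rfl α fun E _ _ _ q hq => hq S z
    exact ⟨g, hg, hg₀⟩
  · intro g h hgh x₀ h₀
    ext x
    obtain ⟨α, hα⟩ := exists_mk_of_proj (hgh x)
    obtain ⟨β, hβ⟩ := exists_mk_of_proj (rfl : proj b₀ (h x) = _)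
    refine hα.trans (Eq.trans ?_ hβ.symm)
    refine mk_eq fun E _ _ _ q hq e e₁ e₂ h₁ h₂ => ?_
    obtain ⟨φ, hφ, hφ'⟩ := exists_map hq h₁.source
    have := (hq S z).unique_lift (φ.comp g) (φ.comp h) (fun y => by simp [hφ, hgh]) x₀
      (by simp [h₀])
    have hx : φ (mk α) = φ (mk β) :=
      (congrArg φ hα).symm.trans ((DFunLike.congr_fun this x).trans (congrArg φ hβ))
    exact (h₁.unique hq.isArcCovering (hφ' _ α)).trans
      (hx.trans ((hφ' _ β).unique hq.isArcCovering h₂))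

variable (b₀) in
theorem isMaximalDiskHedgehogCovering : IsMaximalDiskHedgehogCovering (proj b₀) where
  connectedSpace := connectedSpace b₀
  locallyPathConnectedSpace := locallyPathConnectedSpace b₀
  isDiskHedgehogCovering := isDiskHedgehogCovering b₀
  coveringGE := by
    intro E _ _ _ q hq w e₂ h
    obtain ⟨α, rfl⟩ := exists_mk_of_proj h
    obtain ⟨e₀, he₀⟩ := LiftsTo.exists_of_source hq.isArcCovering α.symm rfl
    obtain ⟨φ, hφ, hφ'⟩ := exists_map hq he₀.target
    exact ⟨φ, hφ, (hφ' _ α).unique hq.isArcCovering (LiftsTo.symm_iff.1 he₀)⟩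

end PathClasses

end Existence

/-- Every path-connected space has a maximal disk-hedgehog covering. -/
theorem exists_isMaximalDiskHedgehogCovering (B : Type u) [TopologicalSpace B]
    [PathConnectedSpace B] :
    ∃ (E : Type u) (_ : TopologicalSpace E) (p : C(E, B)), IsMaximalDiskHedgehogCovering p :=
  ⟨_, _, _, PathClasses.isMaximalDiskHedgehogCovering (Classical.arbitrary B)⟩

/-! ### The hedgehog fundamental group -/

section FundamentalGroup

variable (B : Type u) [TopologicalSpace B] [PathConnectedSpace B]

/-- The total space of a maximal disk-hedgehog covering of `B`. -/
def MaximalCover : Type u := (exists_isMaximalDiskHedgehogCovering B).choose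

noncomputable instance : TopologicalSpace (MaximalCover B) :=
  (exists_isMaximalDiskHedgehogCovering B).choose_spec.choose

/-- A maximal disk-hedgehog covering of `B`; it is unique up to equivalence of coverings. -/
noncomputable def maximalCovering : C(MaximalCover B, B) :=
  (exists_isMaximalDiskHedgehogCovering B).choose_spec.choose_spec.choose

theorem isMaximalDiskHedgehogCovering_maximalCovering :
    IsMaximalDiskHedgehogCovering (maximalCovering B) :=
  (exists_isMaximalDiskHedgehogCovering B).choose_spec.choose_spec.choose_spec

variable {B} in
/-- The hedgehog fundamental group `π(B, b₀)`: the monodromy group at `b₀` of the maximal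
disk-hedgehog covering of `B`. -/
abbrev HedgehogFundamentalGroup (b₀ : B) : Type u :=
  MonodromyGroup (maximalCovering B)
    (isMaximalDiskHedgehogCovering_maximalCovering B).isDiskHedgehogCovering.isArcCovering b₀

end FundamentalGroup

/-- Peano spaces, that is, connected and locally path-connected spaces, are path-connected. -/
instance pathConnectedSpace_of_peano {X : Type*} [TopologicalSpace X] [ConnectedSpace X]
    [LocallyPathConnectedSpace X] : PathConnectedSpace X :=
  PathConnectedSpace.of_locallyPathConnectedSpace

end Hedgehog

/-! Let `p : E → B` be the maximal disk-hedgehog covering and π its monodromy group at `b₀`. As `E`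
is path-connected, π acts transitively on the fibre, so a countable π forces countable fibres. By
maximality deck transformations are transitive on fibres, so the transport along a path is
determined by its value at one point. Small loops must then act trivially
(`exists_isOpen_transport_eq_refl`): otherwise a diagonal argument builds an infinite concatenation
of shrinking loops whose lift ends at none of the points in an enumeration of the fibre. Compactness
makes this uniform: for some `δ`, all loops inside `δ`-balls act trivially.

Now cover `B` by finitely many small balls `W i` with centres `c i`, and let `G` be the group with
generators `t i j` and relations `t i j * t j k = t i k` whenever the three balls have a common
point. It is finitely presented. Sending `t i j` to the loop `b₀ → c i → c j → b₀` defines `r : G →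
π`, since small triangles act trivially. Conversely, the `t i j` are transition functions of a
principal `G`-bundle, a covering space of `B`. Disk-hedgehogs are contractible and locally
path-connected, so this is a disk-hedgehog covering, and by maximality its holonomy is a
homomorphism `s : π → G`.

A map over `B` from the bundle to `E` shows that `r ∘ s` is an inner automorphism
(`apply_holonomy`). Hence π is a retract of `G`, and retracts of finitely presented groups are
finitely presented (`isFinitelyPresented_of_retract`). -/

open Set Topology unitInterval

namespace Hedgehog

universe u

/-! ### Transport along paths and the monodromy action. -/

section Transport

variable {E B : Type*} [TopologicalSpace E] [TopologicalSpace B] {p : C(E, B)}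

/-- The end-point of the lift of a path. -/
noncomputable def liftEnd (hp : IsArcCovering p) {b b' : B} (α : Path b b') (e : {e // p e = b}) :
    {e // p e = b'} :=
  ⟨(LiftsTo.exists_of_source hp α e.2).choose,
    (LiftsTo.exists_of_source hp α e.2).choose_spec.target⟩

theorem liftsTo_liftEnd (hp : IsArcCovering p) {b b' : B} (α : Path b b') (e : {e // p e = b}) :
    LiftsTo p α e (liftEnd hp α e) :=
  (LiftsTo.exists_of_source hp α e.2).choose_spec

/-- Lifting a path gives a bijection between the fibres over its end-points. -/
noncomputable def transport (hp : IsArcCovering p) {b b' : B} (α : Path b b') :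
    {e // p e = b} ≃ {e // p e = b'} where
  toFun := liftEnd hp α
  invFun := liftEnd hp α.symm
  left_inv e := Subtype.ext <|
    (liftsTo_liftEnd hp α.symm _).unique hp (liftsTo_liftEnd hp α e).symm
  right_inv e := Subtype.ext <|
    (liftsTo_liftEnd hp α _).unique hp (LiftsTo.symm_iff.1 (liftsTo_liftEnd hp α.symm e))

variable (hp : IsArcCovering p) {b b' b'' : B}

theorem liftsTo_transport (α : Path b b') (e : {e // p e = b}) :
    LiftsTo p α e (transport hp α e) :=
  liftsTo_liftEnd hp α e

variable {hp} in
theorem LiftsTo.transport_eq {α : Path b b'} {e : {e // p e = b}} {e' : {e // p e = b'}}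
    (h : LiftsTo p α e e') : transport hp α e = e' :=
  Subtype.ext ((liftsTo_transport hp α e).unique hp h)

theorem transport_trans (α : Path b b') (β : Path b' b'') :
    transport hp (α.trans β) = (transport hp α).trans (transport hp β) := by
  ext1 e
  exact ((liftsTo_transport hp α e).trans (liftsTo_transport hp β _)).transport_eq

theorem transport_symm (α : Path b b') : transport hp α.symm = (transport hp α).symm := by
  ext1 e
  refine LiftsTo.transport_eq (LiftsTo.symm_iff.2 ?_)
  simpa using liftsTo_transport hp α ((transport hp α).symm e)

theorem transport_refl (b : B) : transport hp (Path.refl b) = Equiv.refl _ := by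
  ext1 e
  exact (LiftsTo.refl e.2).transport_eq

/-- A map over `B` carries lifts to lifts. This naturality is used for deck transformations, for
comparison with covering spaces and for left translations of bundles. -/
theorem transport_map {E' : Type*} [TopologicalSpace E'] {q : C(E', B)} (hq : IsArcCovering q)
    (f : C(E, E')) (hf : ∀ x, q (f x) = p x) (α : Path b b') (e : {e // p e = b}) :
    transport hq α ⟨f e, (hf e).trans e.2⟩ =
      ⟨f (transport hp α e), (hf _).trans (transport hp α e).2⟩ := by
  obtain ⟨γ, hγ⟩ := liftsTo_transport hp α e
  exact LiftsTo.transport_eq ⟨γ.map f.continuous, fun t => (hf _).trans (hγ t)⟩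

namespace MonodromyGroup

/-- The class of a loop in the monodromy group. -/
def mk (α : Path b b) : MonodromyGroup p hp b := Quotient.mk _ α

variable {hp}

theorem exists_mk (a : MonodromyGroup p hp b) : ∃ α : Path b b, a = mk hp α := by
  induction a using Quotient.inductionOn with
  | h α => exact ⟨α, rfl⟩

theorem mk_eq_iff {α β : Path b b} : mk hp α = mk hp β ↔ transport hp α = transport hp β := by
  refine ⟨fun h => ?_, fun h => Quotient.sound fun e e₁ e₂ h₁ h₂ => ?_⟩
  · ext1 e
    exact Subtype.ext (Quotient.exact h e _ _ (liftsTo_transport hp α e)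
      (liftsTo_transport hp β e))
  · have := congrArg Subtype.val (DFunLike.congr_fun h ⟨e, h₁.source⟩)
    exact (h₁.unique hp (liftsTo_transport hp α ⟨e, h₁.source⟩)).trans
      (this.trans ((liftsTo_transport hp β ⟨e, h₁.source⟩).unique hp h₂))

theorem mk_mul (α β : Path b b) : mk hp α * mk hp β = mk hp (α.trans β) := rfl

theorem one_def : (1 : MonodromyGroup p hp b) = mk hp (Path.refl b) := rfl

/-- The monodromy action on the fibre. -/
noncomputable def act : MonodromyGroup p hp b → ({e // p e = b} ≃ {e // p e = b}) :=
  Quotient.lift (fun α => transport hp α) fun _ _ h => mk_eq_iff.1 (Quotient.sound h)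

@[simp] theorem act_mk (α : Path b b) : (mk hp α).act = transport hp α := rfl

theorem act_mul (x y : MonodromyGroup p hp b) : (x * y).act = x.act.trans y.act := by
  obtain ⟨α, rfl⟩ := exists_mk x
  obtain ⟨β, rfl⟩ := exists_mk y
  rw [mk_mul, act_mk, transport_trans]
  rfl

theorem act_injective : Function.Injective (act : MonodromyGroup p hp b → _) := by
  intro x y h
  obtain ⟨α, rfl⟩ := exists_mk x
  obtain ⟨β, rfl⟩ := exists_mk y
  exact mk_eq_iff.2 h

theorem act_one : (1 : MonodromyGroup p hp b).act = Equiv.refl _ := by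
  rw [one_def, act_mk, transport_refl]

end MonodromyGroup

end Transport

/-! ### Deck transformations and fibres of the maximal covering. -/

section Maximal

variable {E B : Type u} [TopologicalSpace E] [TopologicalSpace B] {p : C(E, B)} {b b' : B}

namespace IsMaximalDiskHedgehogCovering

theorem isArcCovering (hp : IsMaximalDiskHedgehogCovering p) : IsArcCovering p :=
  hp.isDiskHedgehogCovering.isArcCovering

/-- Deck transformations act transitively on the fibres. -/
theorem exists_deck (hp : IsMaximalDiskHedgehogCovering p) {e e' : E} (h : p e = p e') :
    ∃ f : C(E, E), (∀ x, p (f x) = p x) ∧ f e = e' :=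
  have := hp.connectedSpace
  have := hp.locallyPathConnectedSpace
  hp.coveringGE E p hp.isDiskHedgehogCovering e e' h

/-- Every point of the fibre is the image of `e` under a deck transformation, and these commute with
transport. In particular a loop that fixes one point of the fibre fixes all of them. -/
theorem transport_eq_of_apply_eq (hp : IsMaximalDiskHedgehogCovering p) {α β : Path b b'}
    {e : {e // p e = b}}
    (h : transport hp.isArcCovering α e = transport hp.isArcCovering β e) :
    transport hp.isArcCovering α = transport hp.isArcCovering β := by
  ext1 x
  obtain ⟨f, hf, hfx⟩ := hp.exists_deck (e.2.trans x.2.symm)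
  have hx : x = ⟨f e, (hf e).trans e.2⟩ := Subtype.ext hfx.symm
  rw [hx, transport_map hp.isArcCovering hp.isArcCovering f hf,
    transport_map hp.isArcCovering hp.isArcCovering f hf]
  exact Subtype.ext (congrArg (fun y : {e // p e = b'} => f y) h)

theorem exists_transport_eq (hp : IsMaximalDiskHedgehogCovering p) (e : {e // p e = b})
    (e' : {e // p e = b'}) : ∃ α : Path b b', transport hp.isArcCovering α e = e' := by
  have := hp.connectedSpace
  have := hp.locallyPathConnectedSpace
  have γ : Path (e : E) e' := PathConnectedSpace.somePath _ _
  exact ⟨(γ.map p.continuous).cast e.2.symm e'.2.symm, LiftsTo.transport_eq ⟨γ, fun t => rfl⟩⟩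

theorem surjective (hp : IsMaximalDiskHedgehogCovering p) [PathConnectedSpace B] :
    Function.Surjective p := by
  intro b
  have := hp.connectedSpace
  let e : E := Classical.arbitrary E
  exact ⟨_, (transport hp.isArcCovering (PathConnectedSpace.somePath (p e) b) ⟨e, rfl⟩).2⟩

/-- The fibre over `b₀` is a single orbit of the monodromy group; transport carries countability to
the other fibres. -/
theorem countable_fiber [PathConnectedSpace B] (hp : IsMaximalDiskHedgehogCovering p) (b₀ : B)
    [Countable (MonodromyGroup p hp.isArcCovering b₀)] (b : B) : Countable {e // p e = b} := by
  obtain ⟨e₀, he₀⟩ := hp.surjective b₀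
  have h : Countable {e // p e = b₀} := by
    refine Function.Surjective.countable
      (f := fun a : MonodromyGroup p hp.isArcCovering b₀ => a.act ⟨e₀, he₀⟩) fun e => ?_
    obtain ⟨α, hα⟩ := hp.exists_transport_eq ⟨e₀, he₀⟩ e
    exact ⟨MonodromyGroup.mk _ α, hα⟩
  exact (transport hp.isArcCovering (PathConnectedSpace.somePath b b₀)).countable_iff.2 h

end IsMaximalDiskHedgehogCovering

/-- Short paths at `b` do not lead from `e` to another given point of the fibre. -/
theorem IsDiskHedgehogCovering.exists_isOpen_ne (hp : IsDiskHedgehogCovering p)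
    {e e' : {e // p e = b}} (h : e ≠ e') :
    ∃ U : Set B, IsOpen U ∧ b ∈ U ∧ ∀ γ : Path b b, (∀ t, γ t ∈ U) →
      transport hp.isArcCovering γ e ≠ e' := by
  by_cases hW : ∃ W : Set E, IsOpen W ∧ (e : E) ∈ W ∧ (e' : E) ∉ W
  · obtain ⟨W, hW, he, he'⟩ := hW
    obtain ⟨U, hU, hbU, H⟩ := hp.exists_isOpen e.2 hW he
    refine ⟨U, hU, hbU, fun γ hγ hγe => he' ?_⟩
    rw [← hγe]
    exact H b γ hγ _ (liftsTo_transport _ γ e)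
  · push Not at hW
    refine absurd ?_ h
    classical
    -- If every open set around `e` contains `e'`, the jump from `e` to `e'` just after time `0` is
    -- continuous. It is then a second lift of the constant path, against uniqueness.
    let g : C(I, E) := ⟨fun t => if t = 0 then e else e', ⟨fun W hWo => by
      by_cases he : (e : E) ∈ W
      · convert isOpen_univ
        refine eq_univ_of_forall fun t => ?_
        by_cases ht : t = 0 <;> simp [ht, he, hW W hWo he]
      · by_cases he' : (e' : E) ∈ W
        · convert isOpen_compl_singleton (x := (0 : I)) using 1
          ext t
          by_cases ht : t = 0 <;> simp [ht, he, he']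
        · convert isOpen_empty
          refine eq_empty_of_forall_notMem fun t => ?_
          by_cases ht : t = 0 <;> simp [ht, he, he']⟩⟩
    have := hp.isArcCovering.unique_lift (ContinuousMap.const I (e : E)) g (fun t => by
      by_cases ht : t = 0 <;> simp [g, ht, e.2, e'.2]) 0 (by simp [g])
    have h1 := DFunLike.congr_fun this 1
    exact Subtype.ext (by simpa [g] using h1)

end Maximal

/-! ### Infinite concatenation of shrinking loops. -/

section InfiniteConcatenation

variable {X : Type*} [TopologicalSpace X] {b : X}

/-- The concatenation of the first `k` loops of a sequence. -/
noncomputable def partialConcat : ℕ → (ℕ → Path b b) → Path b b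
  | 0, _ => Path.refl b
  | k + 1, ℓ => (ℓ 0).trans (partialConcat k fun n => ℓ (n + 1))

/-- The first `k` loops are run through by the time `1 - 2⁻ᵏ`, so further loops do not affect
earlier values. -/
theorem partialConcat_stable (k j : ℕ) (ℓ : ℕ → Path b b) (t : I)
    (ht : (t : ℝ) ≤ 1 - (1 / 2) ^ k) : partialConcat (k + j) ℓ t = partialConcat k ℓ t := by
  induction k generalizing ℓ t with
  | zero =>
    have h0 : t = 0 := Subtype.ext (le_antisymm (by simpa using ht) t.2.1)
    rw [h0, Path.source, Path.source]
  | succ k ih =>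
    rw [Nat.add_right_comm]
    simp only [partialConcat, Path.trans_apply]
    split_ifs with h
    · rfl
    · refine ih _ _ ?_
      rw [pow_succ] at ht
      show 2 * (t : ℝ) - 1 ≤ _
      linarith

/-- The infinite concatenation of a sequence of loops that shrink to a point. -/
theorem exists_infinite_concatenation (ℓ : ℕ → Path b b) (P : ℕ → Set X) (hP : Antitone P)
    (hℓ : ∀ n t, ℓ n t ∈ P n) (hV : ∀ V ∈ 𝓝 b, ∃ n, P n ⊆ V) :
    ∃ Λ : ℕ → Path b b, (∀ n, Λ n = (ℓ n).trans (Λ (n + 1))) ∧ ∀ n t, Λ n t ∈ P n := by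
  classical
  have hb : ∀ n, b ∈ P n := fun n => by simpa using hℓ n 0
  have hex : ∀ t : I, t ≠ 1 → ∃ k : ℕ, (t : ℝ) < 1 - (1 / 2) ^ k := fun t ht => by
    have h1 : (t : ℝ) < 1 := lt_of_le_of_ne t.2.2 fun h => ht (Subtype.ext h)
    obtain ⟨k, hk⟩ := exists_pow_lt_of_lt_one (sub_pos.2 h1) (by norm_num : (1 / 2 : ℝ) < 1)
    exact ⟨k, by linarith⟩
  -- Before time `1` the value is read off any sufficiently long finite concatenation; only `t = 1`
  -- falls into the default case `b`.
  let L : ℕ → I → X := fun n t =>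
    if h : ∃ k : ℕ, (t : ℝ) ≤ 1 - (1 / 2) ^ k then
      partialConcat (Nat.find h) (fun m => ℓ (n + m)) t else b
  have hL : ∀ n k (t : I), (t : ℝ) ≤ 1 - (1 / 2) ^ k →
      L n t = partialConcat k (fun m => ℓ (n + m)) t := by
    intro n k t ht
    have h : ∃ k : ℕ, (t : ℝ) ≤ 1 - (1 / 2) ^ k := ⟨k, ht⟩
    obtain ⟨j, hj⟩ := Nat.exists_eq_add_of_le (Nat.find_min' h ht)
    have hLn : L n t = partialConcat (Nat.find h) (fun m => ℓ (n + m)) t := dif_pos h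
    rw [hLn, ← partialConcat_stable (Nat.find h) j _ t (Nat.find_spec h), ← hj]
  have hL1 : ∀ n, L n 1 = b := fun n => by
    refine dif_neg ?_
    rintro ⟨k, hk⟩
    have : (0 : ℝ) < (1 / 2) ^ k := by positivity
    simp only [Icc.coe_one] at hk
    linarith
  have hhalf : ∀ n (t : I) (h : (t : ℝ) ≤ 1 / 2),
      L n t = ℓ n ⟨2 * t, (unitInterval.mul_pos_mem_iff zero_lt_two).2 ⟨t.2.1, h⟩⟩ := by
    intro n t h
    rw [hL n 1 t (by norm_num; linarith)]
    simp only [partialConcat, Path.trans_apply, h, dite_true]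
    rfl
  have hhalf' : ∀ n (t : I) (h : ¬ (t : ℝ) ≤ 1 / 2),
      L n t = L (n + 1) ⟨2 * t - 1, two_mul_sub_one_mem_iff.2 ⟨(not_le.1 h).le, t.2.2⟩⟩ := by
    intro n t h
    by_cases ht : t = 1
    · subst ht
      rw [hL1, ← hL1 (n + 1)]
      congr 1
      ext
      norm_num
    · obtain ⟨k, hk⟩ := hex t ht
      have hk' : (t : ℝ) ≤ 1 - (1 / 2) ^ (k + 1) := by
        have : (0 : ℝ) < (1 / 2) ^ k := by positivity
        rw [pow_succ]
        linarith
      rw [hL n (k + 1) t hk', hL (n + 1) k _ (by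
        show 2 * (t : ℝ) - 1 ≤ _
        rw [pow_succ] at hk'
        linarith)]
      simp only [partialConcat, Path.trans_apply, h, dite_false]
      congr 2
      ext m
      congr 2
      ring
  -- From time `1 - 2⁻ᵏ` on, only loops with index at least `n + k` are traversed. This gives
  -- continuity at time `1`.
  have hmem : ∀ k n (t : I), (1 : ℝ) - (1 / 2) ^ k ≤ t → L n t ∈ P (n + k) := by
    have hmem0 : ∀ n t, L n t ∈ P n := by
      have : ∀ k (ℓ' : ℕ → Path b b) n, (∀ m t, ℓ' m t ∈ P n) → ∀ t,
          partialConcat k ℓ' t ∈ P n := by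
        intro k
        induction k with
        | zero => exact fun ℓ' n _ t => hb n
        | succ k ih =>
          intro ℓ' n hℓ' t
          simp only [partialConcat, Path.trans_apply]
          split_ifs
          · exact hℓ' _ _
          · exact ih _ n (fun m t => hℓ' _ _) _
      intro n t
      by_cases ht : t = 1
      · rw [ht, hL1]
        exact hb n
      · obtain ⟨k, hk⟩ := hex t ht
        rw [hL n k t hk.le]
        exact this k _ n (fun m t => hP (Nat.le_add_right n m) (hℓ _ t)) t
    intro k
    induction k with
    | zero => exact fun n t _ => hmem0 n t
    | succ k ih =>
      intro n t ht
      rw [pow_succ] at ht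
      by_cases h : (t : ℝ) ≤ 1 / 2
      · have hk1 : (1 / 2 : ℝ) ^ k = 1 :=
          le_antisymm (pow_le_one₀ (by norm_num) (by norm_num)) (by linarith)
        have ht' : (t : ℝ) = 1 / 2 := by
          rw [hk1] at ht
          linarith
        have : L n t = b := by
          rw [hhalf n t h, show (⟨2 * t, _⟩ : I) = 1 from Subtype.ext (by
            show 2 * (t : ℝ) = 1
            linarith), (ℓ n).target]
        rw [this]
        exact hb _
      · rw [hhalf' n t h]
        have := ih (n + 1) ⟨2 * t - 1, two_mul_sub_one_mem_iff.2 ⟨(not_le.1 h).le, t.2.2⟩⟩ (by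
          show (1 : ℝ) - (1 / 2) ^ k ≤ 2 * t - 1
          linarith)
        rwa [show n + (k + 1) = n + 1 + k by ring]
  have hcont : ∀ n, Continuous (L n) := by
    intro n
    rw [continuous_iff_continuousAt]
    intro t
    by_cases ht : t = 1
    · subst ht
      intro V hVn
      rw [hL1] at hVn
      obtain ⟨k, hk⟩ := hV V hVn
      have hopen : {t : I | (1 : ℝ) - (1 / 2) ^ k < t} ∈ 𝓝 (1 : I) :=
        (isOpen_lt continuous_const continuous_subtype_val).mem_nhds (by simp)
      refine Filter.mem_map.2 (Filter.mem_of_superset hopen fun t ht => hk ?_)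
      exact hP (Nat.le_add_left k n) (hmem k n t (le_of_lt ht))
    · obtain ⟨k, hk⟩ := hex t ht
      have hopen : {t : I | (t : ℝ) < 1 - (1 / 2) ^ k} ∈ 𝓝 t :=
        (isOpen_lt continuous_subtype_val continuous_const).mem_nhds hk
      refine (partialConcat k fun m => ℓ (n + m)).continuous.continuousAt.congr ?_
      exact Filter.mem_of_superset hopen fun s hs => (hL n k s (le_of_lt hs)).symm
  have hL0 : ∀ n, L n 0 = b := fun n => by
    rw [hhalf n 0 (by norm_num)]
    convert (ℓ n).source
    norm_num
  refine ⟨fun n => ⟨⟨L n, hcont n⟩, hL0 n, hL1 n⟩, fun n => ?_, fun n t => ?_⟩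
  · ext t
    rw [Path.trans_apply]
    split_ifs with h
    · exact hhalf n t h
    · exact hhalf' n t h
  · exact hmem 0 n t (by simpa using t.2.1)

end InfiniteConcatenation

/-! ### Countable fibres make small loops act trivially. -/

section SemilocallyTrivial

variable {E B : Type u} [TopologicalSpace E] [TopologicalSpace B] {p : C(E, B)}

namespace IsMaximalDiskHedgehogCovering

/-- If the fibre over `b` is countable, then small loops at `b` act trivially on it. -/
theorem exists_isOpen_transport_eq_refl [FirstCountableTopology B]
    (hp : IsMaximalDiskHedgehogCovering p) (b : B) [Countable {e // p e = b}] :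
    ∃ U : Set B, IsOpen U ∧ b ∈ U ∧ ∀ γ : Path b b, (∀ t, γ t ∈ U) →
      transport hp.isArcCovering γ = Equiv.refl _ := by
  by_contra! hcon
  have : Nonempty {e // p e = b} := by
    by_contra hempty
    rw [not_nonempty_iff] at hempty
    obtain ⟨γ, -, hγ⟩ := hcon univ isOpen_univ trivial
    exact hγ (Subsingleton.elim _ _)
  obtain ⟨x, hx⟩ := exists_surjective_nat {e // p e = b}
  obtain ⟨V, hV⟩ := (𝓝 b).exists_antitone_basis
  -- A state consists of the point reached so far and a neighbourhood that confines all later loops.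
  -- Stage `n` adds a loop and shrinks the neighbourhood so that no later motion can end at `x n`.
  have step : ∀ (n : ℕ) (s : {e // p e = b} × {U : Set B // IsOpen U ∧ b ∈ U}),
      ∃ (s' : {e // p e = b} × {U : Set B // IsOpen U ∧ b ∈ U}) (ℓ : Path b b),
        (∀ t, ℓ t ∈ s.2.1 ∩ V n) ∧ transport hp.isArcCovering ℓ s.1 = s'.1 ∧
        s'.2.1 ⊆ s.2.1 ∧
        ∀ γ : Path b b, (∀ t, γ t ∈ s'.2.1) → transport hp.isArcCovering γ s'.1 ≠ x n := by
    rintro n ⟨y, U, hU, hbU⟩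
    obtain ⟨ℓ, hℓ, hne⟩ : ∃ ℓ : Path b b, (∀ t, ℓ t ∈ U ∩ V n) ∧
        transport hp.isArcCovering ℓ y ≠ x n := by
      -- At `x n` a short loop with nontrivial action is needed: it moves `x n`, since fixing one
      -- point would mean acting trivially. Elsewhere the constant loop does.
      by_cases hy : y = x n
      · obtain ⟨W, hWV, hW, hbW⟩ := mem_nhds_iff.1 (hV.mem n)
        obtain ⟨γ, hγ, hne⟩ := hcon (U ∩ W) (hU.inter hW) ⟨hbU, hbW⟩
        refine ⟨γ, fun t => ⟨(hγ t).1, hWV (hγ t).2⟩, fun h => hne ?_⟩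
        rw [← transport_refl hp.isArcCovering b]
        refine hp.transport_eq_of_apply_eq (e := y) ?_
        rw [h, transport_refl, ← hy]
        rfl
      · refine ⟨Path.refl b, fun t => ⟨hbU, mem_of_mem_nhds (hV.mem n)⟩, ?_⟩
        rw [transport_refl]
        exact hy
    obtain ⟨U', hU', hbU', h⟩ := hp.isDiskHedgehogCovering.exists_isOpen_ne hne
    exact ⟨⟨_, U ∩ U', hU.inter hU', hbU, hbU'⟩, ℓ, hℓ, rfl, inter_subset_left,
      fun γ hγ => h γ fun t => (hγ t).2⟩
  choose next ℓ hℓ htr hsub hne using step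
  let s : ℕ → {e // p e = b} × {U : Set B // IsOpen U ∧ b ∈ U} := fun n =>
    Nat.rec ⟨x 0, univ, isOpen_univ, trivial⟩ (fun n s => next n s) n
  obtain ⟨Λ, hΛ, hΛmem⟩ := exists_infinite_concatenation (fun n => ℓ n (s n))
    (fun n => (s n).2.1 ∩ V n)
    (Antitone.inf (antitone_nat_of_succ_le fun n => hsub n (s n)) hV.antitone)
    (fun n => hℓ n (s n)) (fun W hW => by
      obtain ⟨n, -, hn⟩ := hV.toHasBasis.mem_iff.1 hW
      exact ⟨n, inter_subset_right.trans hn⟩)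
  -- The infinite loop from the initial point ends where its tail `Λ n` ends from the `n`-th point.
  -- If the end-point is `x m`, the tail `Λ (m + 1)` violates the choice made at stage `m`.
  have key : ∀ n, transport hp.isArcCovering (Λ n) (s n).1 =
      transport hp.isArcCovering (Λ 0) (s 0).1 := by
    intro n
    induction n with
    | zero => rfl
    | succ n ih =>
      rw [← ih, hΛ n, transport_trans, Equiv.trans_apply, htr]
  obtain ⟨m, hm⟩ := hx (transport hp.isArcCovering (Λ 0) (s 0).1)
  exact hne m (s m) (Λ (m + 1)) (fun t => (hΛmem (m + 1) t).1) ((key (m + 1)).trans hm.symm)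

end IsMaximalDiskHedgehogCovering

end SemilocallyTrivial

/-! ### Contractibility of disk-hedgehogs. -/

section Contractible

/-- The straight-line contraction of the disk to one of its points. -/
noncomputable def diskContraction (z : Disk) : C(Disk × I, Disk) where
  toFun x := ⟨(1 - (x.2 : ℝ)) • (x.1 : EuclideanSpace ℝ (Fin 2)) + (x.2 : ℝ) • z.1,
    convex_closedBall _ _ x.1.2 z.2 (sub_nonneg.2 x.2.2.2) x.2.2.1 (sub_add_cancel _ _)⟩
  continuous_toFun := by fun_prop

theorem diskContraction_zero (z x : Disk) : diskContraction z (x, 0) = x := by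
  ext1
  simp [diskContraction]

theorem diskContraction_one (z x : Disk) : diskContraction z (x, 1) = z := by
  ext1
  simp [diskContraction]

theorem diskContraction_base (z : Disk) (t : I) : diskContraction z (z, t) = z := by
  ext1
  simp [diskContraction, ← add_smul]

variable {S : Type u} [Preorder S] [IsDirectedOrder S] [Nonempty S] (z : S → Disk)

/-- The paths traced by the points of a disk-hedgehog as it is contracted to its base point. -/
noncomputable def hedgehogContraction : C(DiskHedgehog z, C(I, DiskHedgehog z)) where
  toFun := DirectedWedge.desc
    (fun s => ContinuousMap.curry
      ⟨fun x => DirectedWedge.incl z s (diskContraction (z s) x),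
        (DirectedWedge.continuous_incl s).comp (diskContraction (z s)).continuous⟩)
    (fun s t => by
      ext r
      simp only [ContinuousMap.curry_apply, ContinuousMap.coe_mk, diskContraction_base]
      exact DirectedWedge.incl_base s t)
  continuous_toFun := by
    -- At the base point, `U` contains all disks beyond some index, and each disk stays inside
    -- itself during the contraction. The empty `K` is separate because it gives no information on
    -- `U`.
    refine ContinuousMap.continuous_compactOpen.2 fun K hK U hU => ?_
    refine DirectedWedge.isOpen_iff.2 ⟨fun s => ?_, ?_⟩
    · exact (ContinuousMap.isOpen_setOfPred_mapsTo hK hU).preimage (ContinuousMap.curry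
        ⟨fun x => DirectedWedge.incl z s (diskContraction (z s) x),
          (DirectedWedge.continuous_incl s).comp (diskContraction (z s)).continuous⟩).continuous
    · rintro ⟨s, hs⟩
      rcases K.eq_empty_or_nonempty with rfl | ⟨r, hr⟩
      · exact ⟨s, fun _ _ _ => mapsTo_empty _ _⟩
      · have h : DirectedWedge.incl z s (diskContraction (z s) (z s, r)) ∈ U := hs hr
        rw [diskContraction_base] at h
        obtain ⟨t, ht⟩ := (DirectedWedge.isOpen_iff.1 hU).2 ⟨s, h⟩
        exact ⟨t, fun s' hs' x r' _ => ht s' hs' _⟩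

theorem hedgehogContraction_incl (s : S) (x : Disk) (t : I) :
    hedgehogContraction z (DirectedWedge.incl z s x) t =
      DirectedWedge.incl z s (diskContraction (z s) (x, t)) := rfl

/-- The contraction is used in curried form because the wedge topology directly describes maps out
of the wedge, not out of its product with `I`. Evaluation on paths is jointly continuous, as `I` is
locally compact. -/
theorem contractibleSpace_diskHedgehog : ContractibleSpace (DiskHedgehog z) := by
  rw [contractible_iff_id_nullhomotopic]
  let s₀ : S := Classical.arbitrary S
  refine ⟨DirectedWedge.incl z s₀ (z s₀), ⟨⟨⟨fun x => hedgehogContraction z x.2 x.1, ?_⟩, ?_, ?_⟩⟩⟩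
  · fun_prop
  · intro w
    obtain ⟨s, x, rfl⟩ := DirectedWedge.exists_incl w
    simp [hedgehogContraction_incl, diskContraction_zero]
  · intro w
    obtain ⟨s, x, rfl⟩ := DirectedWedge.exists_incl w
    simp only [ContinuousMap.const_apply, hedgehogContraction_incl, diskContraction_one]
    exact DirectedWedge.incl_base s s₀

end Contractible

/-! ### Covering spaces as disk-hedgehog coverings. -/

section Coverings

theorem hasUniqueLifts_of_isCoveringMap {E B : Type*} [TopologicalSpace E] [TopologicalSpace B]
    {p : C(E, B)} (hp : IsCoveringMap p) (X : Type*) [TopologicalSpace X] [SimplyConnectedSpace X]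
    [LocallyPathConnectedSpace X] : HasUniqueLifts p X where
  exists_lift e₀ x₀ f hf := by
    obtain ⟨F, ⟨hF₀, hF⟩, -⟩ := hp.existsUnique_continuousMap_lifts f x₀ e₀ hf.symm
    exact ⟨F, fun x => congrFun hF x, hF₀⟩
  unique_lift g h hgh x₀ h₀ := DFunLike.coe_injective
    (hp.eq_of_comp_eq g.continuous h.continuous (funext hgh) x₀ h₀)

theorem isDiskHedgehogCovering_of_isCoveringMap {E B : Type u} [TopologicalSpace E]
    [TopologicalSpace B] {p : C(E, B)} (hp : IsCoveringMap p) : IsDiskHedgehogCovering p := by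
  intro S _ _ _ z
  have := contractibleSpace_diskHedgehog z
  have : LocallyPathConnectedSpace (DiskHedgehog z) := DirectedWedge.locallyPathConnectedSpace
  exact hasUniqueLifts_of_isCoveringMap hp _

/-- The local homeomorphism provides charts of `E` modelled on `B`. -/
theorem locallyPathConnectedSpace_of_isLocalHomeomorph {E B : Type*} [TopologicalSpace E]
    [TopologicalSpace B] [LocallyPathConnectedSpace B] {p : E → B} (hp : IsLocalHomeomorph p) :
    LocallyPathConnectedSpace E :=
  let _ : ChartedSpace B E :=
    { atlas := univ
      chartAt := fun x => (hp x).choose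
      mem_chart_source := fun x => (hp x).choose_spec.1
      chart_mem_atlas := fun _ => trivial }
  ChartedSpace.locallyPathConnectedSpace B E

/-- Unique lifting of maps from path-connected spaces is inherited by path-components of the
total space. -/
theorem HasUniqueLifts.restrict_pathComponent {E B : Type*} [TopologicalSpace E]
    [TopologicalSpace B] {p : C(E, B)} {X : Type*} [TopologicalSpace X] [PathConnectedSpace X]
    (h : HasUniqueLifts p X) (e : E) : HasUniqueLifts (p.restrict (pathComponent e)) X where
  exists_lift e₀ x₀ f hf := by
    obtain ⟨g, hg, hg₀⟩ := h.exists_lift e₀ x₀ f hf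
    have hmem : ∀ x, g x ∈ pathComponent e := fun x => by
      have h₀ : Joined e (g x₀) := hg₀ ▸ e₀.2
      exact h₀.trans ((PathConnectedSpace.joined x₀ x).map g.continuous)
    exact ⟨⟨fun x => ⟨g x, hmem x⟩, by fun_prop⟩, hg, Subtype.ext hg₀⟩
  unique_lift g g' hgg x₀ h₀ := by
    have := h.unique_lift ⟨fun x => g x, by fun_prop⟩ ⟨fun x => g' x, by fun_prop⟩ hgg x₀
      (congrArg Subtype.val h₀)
    ext x
    exact DFunLike.congr_fun this x

/-- Loops that lift to closed loops in the maximal disk-hedgehog covering lift to closed loops in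
every covering space; more generally, lifts of paths to a covering are determined by their lifts
to the maximal disk-hedgehog covering. -/
theorem IsMaximalDiskHedgehogCovering.transport_eq_of_isCoveringMap {E E' B : Type u}
    [TopologicalSpace E] [TopologicalSpace B] [TopologicalSpace E'] [LocallyPathConnectedSpace B]
    [PathConnectedSpace B]
    {p : C(E, B)} (hp : IsMaximalDiskHedgehogCovering p) {q : C(E', B)} (hq : IsCoveringMap q)
    {b b' : B} {α β : Path b b'}
    (h : transport hp.isArcCovering α = transport hp.isArcCovering β) :
    transport (isDiskHedgehogCovering_of_isCoveringMap hq).isArcCovering α =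
      transport (isDiskHedgehogCovering_of_isCoveringMap hq).isArcCovering β := by
  ext1 ⟨x, hx⟩
  obtain ⟨e, he⟩ := hp.surjective b
  have := locallyPathConnectedSpace_of_isLocalHomeomorph hq.isLocalHomeomorph
  -- Maximality concerns Peano total spaces only, and `E'` may be disconnected, so it is applied to
  -- the path-component of `x`.
  have : LocallyPathConnectedSpace (pathComponent x) :=
    (IsOpen.pathComponent x).locallyPathConnectedSpace
  have : PathConnectedSpace (pathComponent x) :=
    isPathConnected_iff_pathConnectedSpace.1 isPathConnected_pathComponent
  have hq' : IsDiskHedgehogCovering (q.restrict (pathComponent x)) := fun S _ _ _ z =>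
    have : PathConnectedSpace (DiskHedgehog z) := DirectedWedge.pathConnectedSpace
    (isDiskHedgehogCovering_of_isCoveringMap hq S z).restrict_pathComponent x
  obtain ⟨f, hf, hfe⟩ := hp.coveringGE (pathComponent x) _ hq' e
    ⟨x, mem_pathComponent_self x⟩ (he.trans hx.symm)
  have key (γ : Path b b') := transport_map hp.isArcCovering
    (isDiskHedgehogCovering_of_isCoveringMap hq).isArcCovering
    ⟨fun y => (f y : E'), by fun_prop⟩ hf γ ⟨e, he⟩
  have hxe : (⟨x, hx⟩ : {x // q x = b}) = ⟨f e, (hf e).trans he⟩ :=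
    Subtype.ext (congrArg Subtype.val hfe).symm
  rw [hxe]
  exact (key α).trans ((Subtype.ext (by rw [h])).trans (key β).symm)

end Coverings

/-! ### The principal bundle of a constant cocycle. -/

section CocycleBundle

variable {ι : Type*} {B : Type*} [TopologicalSpace B] {G : Type*} [Group G] [TopologicalSpace G]
  [DiscreteTopology G] {W : ι → Set B}

/-- The principal bundle with discrete structure group and constant transition functions `t i j`. -/
def cocycleBundle (hW : ∀ i, IsOpen (W i)) (ind : B → ι) (hind : ∀ b, b ∈ W (ind b))
    (t : ι → ι → G) (ht : ∀ i j k, (W i ∩ W j ∩ W k).Nonempty → t i j * t j k = t i k) :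
    FiberBundleCore ι B G where
  baseSet := W
  isOpen_baseSet := hW
  indexAt := ind
  mem_baseSet_at := hind
  -- Right multiplication leaves left translations available as a global action on the total space.
  coordChange i j _ v := v * t i j
  coordChange_self i x hx v := by
    -- The relation for `i, i, i` makes `t i i` idempotent, hence trivial.
    have := ht i i i ⟨x, ⟨hx, hx⟩, hx⟩
    rw [mul_eq_left.1 this, mul_one]
  continuousOn_coordChange i j :=
    (continuous_of_discreteTopology (f := fun v : G => v * t i j)).comp_continuousOn
      continuous_snd.continuousOn
  coordChange_comp i j k x hx v := by rw [mul_assoc, ht i j k ⟨x, hx⟩]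

variable (hW : ∀ i, IsOpen (W i)) (ind : B → ι) (hind : ∀ b, b ∈ W (ind b))
    (t : ι → ι → G) (ht : ∀ i j k, (W i ∩ W j ∩ W k).Nonempty → t i j * t j k = t i k)

/-- The total space of the bundle given by a cocycle. -/
abbrev CocycleCover : Type _ := (cocycleBundle hW ind hind t ht).TotalSpace

/-- The projection of the bundle given by a cocycle. -/
def cocycleProj : C(CocycleCover hW ind hind t ht, B) :=
  ⟨Bundle.TotalSpace.proj, (cocycleBundle hW ind hind t ht).continuous_proj⟩

theorem isCoveringMap_cocycleProj : IsCoveringMap (cocycleProj hW ind hind t ht) :=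
  FiberBundle.isCoveringMap (F := G) (E := (cocycleBundle hW ind hind t ht).Fiber)

variable {hW ind hind t ht}

namespace CocycleCover

/-- The point with coordinate `g` over `b`. -/
def mk (b : B) (g : G) : CocycleCover hW ind hind t ht := ⟨b, g⟩

/-- The coordinate of a point. -/
def coord (x : CocycleCover hW ind hind t ht) : G := x.2

@[simp] theorem coord_mk (b : B) (g : G) : coord (mk (hW := hW) (hind := hind) (ht := ht) b g) = g :=
  rfl

theorem continuousAt_iff {X : Type*} [TopologicalSpace X] {f : X → CocycleCover hW ind hind t ht}
    {x₀ : X} : ContinuousAt f x₀ ↔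
      ContinuousAt (fun x => cocycleProj hW ind hind t ht (f x)) x₀ ∧
        ContinuousAt (fun x => (f x).coord * t (ind (cocycleProj hW ind hind t ht (f x)))
          (ind (cocycleProj hW ind hind t ht (f x₀)))) x₀ :=
  FiberBundle.continuousAt_totalSpace G f

/-- The coordinate in a fixed chart is locally constant. -/
theorem eventually_coord_mul (x₀ : CocycleCover hW ind hind t ht) :
    ∀ᶠ x in 𝓝 x₀, x.coord * t (ind (cocycleProj hW ind hind t ht x))
      (ind (cocycleProj hW ind hind t ht x₀)) = x₀.coord := by
  have h := (continuousAt_iff (f := fun x : CocycleCover hW ind hind t ht => x)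
    (x₀ := x₀)).1 continuousAt_id
  have h₁ := h.2.eventually (isOpen_discrete {x₀.coord * t (ind (cocycleProj hW ind hind t ht x₀))
      (ind (cocycleProj hW ind hind t ht x₀))} |>.mem_nhds rfl)
  filter_upwards [h₁] with x hx
  rw [mem_singleton_iff.1 hx]
  have hb := hind (cocycleProj hW ind hind t ht x₀)
  rw [mul_eq_left.1 (ht _ _ _ ⟨_, ⟨hb, hb⟩, hb⟩), mul_one]

/-- The structure group acts on the total space by left translations. -/
def leftMul (g : G) : C(CocycleCover hW ind hind t ht, CocycleCover hW ind hind t ht) where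
  toFun x := mk (cocycleProj hW ind hind t ht x) (g * x.coord)
  continuous_toFun := by
    refine continuous_iff_continuousAt.2 fun x₀ => continuousAt_iff.2
      ⟨(cocycleProj hW ind hind t ht).continuous.continuousAt, ?_⟩
    have h := ((continuousAt_iff (f := fun x : CocycleCover hW ind hind t ht => x)
      (x₀ := x₀)).1 continuousAt_id).2
    refine ((continuous_of_discreteTopology (f := fun v : G => g * v)).continuousAt.comp
      h).congr (Filter.Eventually.of_forall fun x => ?_)
    exact (mul_assoc _ _ _).symm

end CocycleCover

end CocycleBundle

/-! ### The holonomy homomorphism from the monodromy group to the structure group. -/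

section Holonomy

open CocycleCover

variable {ι : Type u} {E B : Type u} [TopologicalSpace E] [TopologicalSpace B]
  {G : Type u} [Group G] [TopologicalSpace G] [DiscreteTopology G] {W : ι → Set B} {p : C(E, B)}

variable (hp : IsMaximalDiskHedgehogCovering p) (hW : ∀ i, IsOpen (W i)) (ind : B → ι)
  (hind : ∀ b, b ∈ W (ind b))
  (t : ι → ι → G) (ht : ∀ i j k, (W i ∩ W j ∩ W k).Nonempty → t i j * t j k = t i k) (b₀ : B)

theorem isArcCovering_cocycleProj : IsArcCovering (cocycleProj hW ind hind t ht) :=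
  (isDiskHedgehogCovering_of_isCoveringMap
    (isCoveringMap_cocycleProj hW ind hind t ht)).isArcCovering

/-- The holonomy of a loop in the bundle given by a cocycle. -/
noncomputable def loopHolonomy (α : Path b₀ b₀) : G :=
  coord (transport (isArcCovering_cocycleProj hW ind hind t ht) α ⟨mk b₀ 1, rfl⟩).1

-- Left translations are maps over `B`, so they commute with transport, and the point with
-- coordinate `g` is a translate of the one with coordinate `1`.
variable {b₀} in
theorem transport_cocycleProj (α : Path b₀ b₀) (g : G) :
    transport (isArcCovering_cocycleProj hW ind hind t ht) α ⟨mk b₀ g, rfl⟩ =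
      ⟨mk b₀ (g * loopHolonomy hW ind hind t ht b₀ α), rfl⟩ := by
  have h := transport_map (isArcCovering_cocycleProj hW ind hind t ht)
    (isArcCovering_cocycleProj hW ind hind t ht) (leftMul g) (fun _ => rfl) α ⟨mk b₀ 1, rfl⟩
  have h' : (⟨mk b₀ g, rfl⟩ : {x // cocycleProj hW ind hind t ht x = b₀}) =
      ⟨leftMul g (mk b₀ 1), rfl⟩ := Subtype.ext (congrArg (mk b₀) (mul_one g).symm)
  rw [h', h]
  refine Subtype.ext ?_
  have h₁ := (transport (isArcCovering_cocycleProj hW ind hind t ht) α ⟨mk b₀ 1, rfl⟩).2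
  exact congrArg (fun b => mk b _) h₁

variable [LocallyPathConnectedSpace B] [PathConnectedSpace B]

/-- The holonomy homomorphism from the monodromy group of the maximal disk-hedgehog covering to
the structure group of a bundle. -/
noncomputable def holonomy : MonodromyGroup p hp.isArcCovering b₀ →* G :=
  MonoidHom.mk' (Quotient.lift (loopHolonomy hW ind hind t ht b₀) fun α β h => by
    have := hp.transport_eq_of_isCoveringMap (isCoveringMap_cocycleProj hW ind hind t ht)
      (MonodromyGroup.mk_eq_iff.1 (Quotient.sound h))
    unfold loopHolonomy
    rw [this]) fun x y => by
    obtain ⟨α, rfl⟩ := MonodromyGroup.exists_mk x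
    obtain ⟨β, rfl⟩ := MonodromyGroup.exists_mk y
    show loopHolonomy hW ind hind t ht b₀ (α.trans β) = loopHolonomy hW ind hind t ht b₀ α *
      loopHolonomy hW ind hind t ht b₀ β
    have h := transport_cocycleProj hW ind hind t ht (α.trans β) 1
    rw [transport_trans, Equiv.trans_apply, transport_cocycleProj, transport_cocycleProj] at h
    simpa using (congrArg (fun x => coord x.1) h).symm

theorem holonomy_mk (α : Path b₀ b₀) :
    holonomy hp hW ind hind t ht b₀ (MonodromyGroup.mk _ α) =
      loopHolonomy hW ind hind t ht b₀ α := rfl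

end Holonomy

/-! ### Comparison of the bundle with the maximal covering. -/

section Retraction

open CocycleCover

variable {ι : Type u} {E B : Type u} [TopologicalSpace E] [TopologicalSpace B]
  {G : Type u} [Group G] {W : ι → Set B} {p : C(E, B)}
  (hp : IsArcCovering p) {b₀ : B} (c : ι → B) (κ : ∀ x y : B, Path x y)
  (r : G →* MonodromyGroup p hp b₀)

/-- The identification of the fibre over `b₀` with the fibre over `b` given by a coordinate `g` in
the chart `i`. -/
noncomputable def frame (i : ι) (b : B) (g : G) : {e // p e = b₀} ≃ {e // p e = b} :=
  ((r g).act.trans (transport hp (κ b₀ (c i)))).trans (transport hp (κ (c i) b))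

variable {hp c κ r} {t : ι → ι → G}

/-- The loop for `t i j` returns along the path by which the frame of chart `j` leaves `b₀`. After
cancellation the triangle `c i, c j, b` remains. Thus frames respect the change of charts. -/
theorem frame_mul (hr : ∀ i j, r (t i j) = MonodromyGroup.mk hp
      (((κ b₀ (c i)).trans (κ (c i) (c j))).trans (κ b₀ (c j)).symm))
    {i j : ι} {b : B}
    (h : (transport hp (κ (c i) (c j))).trans (transport hp (κ (c j) b)) =
      transport hp (κ (c i) b)) (g : G) :
    frame hp c κ r j b (g * t i j) = frame hp c κ r i b g := by
  ext1 e
  simp only [frame, map_mul, hr, MonodromyGroup.act_mul, MonodromyGroup.act_mk, transport_trans,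
    transport_symm, Equiv.trans_apply, Equiv.apply_symm_apply, ← h]

variable [TopologicalSpace G] [DiscreteTopology G] {hW : ∀ i, IsOpen (W i)} {ind : B → ι} {hind : ∀ b, b ∈ W (ind b)}
  {ht : ∀ i j k, (W i ∩ W j ∩ W k).Nonempty → t i j * t j k = t i k}

/-- The frames glue to a map over `B`. Here `hκ` makes them independent of the chart, `hκ'` makes
them locally constant under transport, and `hopen` turns this into continuity for the topology of
`E`. -/
theorem exists_map_cocycleCover [LocallyPathConnectedSpace B]
    (hr : ∀ i j, r (t i j) = MonodromyGroup.mk hp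
      (((κ b₀ (c i)).trans (κ (c i) (c j))).trans (κ b₀ (c j)).symm))
    (hκ : ∀ i j b, b ∈ W i → b ∈ W j →
      (transport hp (κ (c i) (c j))).trans (transport hp (κ (c j) b)) = transport hp (κ (c i) b))
    (hκ' : ∀ i b, b ∈ W i → ∃ U, IsOpen U ∧ b ∈ U ∧ ∀ b' (β : Path b b'), (∀ s, β s ∈ U) →
      b' ∈ W i ∧ (transport hp (κ (c i) b)).trans (transport hp β) = transport hp (κ (c i) b'))
    (hopen : ∀ {b : B} {x : E}, p x = b → ∀ {O : Set E}, IsOpen O → x ∈ O →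
      ∃ U : Set B, IsOpen U ∧ b ∈ U ∧ ∀ (b' : B) (γ : Path b b'), (∀ t, γ t ∈ U) →
        ∀ x', LiftsTo p γ x x' → x' ∈ O)
    (e : {e // p e = b₀}) :
    ∃ f : C(CocycleCover hW ind hind t ht, E), ∀ x, f x =
      frame hp c κ r (ind (cocycleProj hW ind hind t ht x)) (cocycleProj hW ind hind t ht x)
        x.coord e := by
  refine ⟨⟨fun x => frame hp c κ r (ind (cocycleProj hW ind hind t ht x))
    (cocycleProj hW ind hind t ht x) x.coord e, ⟨fun O hO => ?_⟩⟩, fun x => rfl⟩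
  refine isOpen_iff_mem_nhds.2 fun x₀ hx₀ => ?_
  set b := cocycleProj hW ind hind t ht x₀ with hb
  obtain ⟨U, hU, hbU, H⟩ := hκ' (ind b) b (hind b)
  obtain ⟨U', hU', hbU', H'⟩ := hopen (frame hp c κ r (ind b) b x₀.coord e).2 hO hx₀
  have hN : pathComponentIn (U ∩ U') b ∈ 𝓝 b :=
    pathComponentIn_mem_nhds ((hU.inter hU').mem_nhds ⟨hbU, hbU'⟩)
  filter_upwards [eventually_coord_mul x₀,
    (cocycleProj hW ind hind t ht).continuous.continuousAt.preimage_mem_nhds hN] with x hx hxN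
  set b' := cocycleProj hW ind hind t ht x with hb'
  obtain ⟨β, hβ⟩ : JoinedIn (U ∩ U') b b' := hxN
  obtain ⟨hb'W, hβtr⟩ := H b' β fun s => (hβ s).1
  refine H' b' β (fun s => (hβ s).2) _ ?_
  have h : frame hp c κ r (ind b') b' x.coord e =
      transport hp β (frame hp c κ r (ind b) b x₀.coord e) := by
    -- Pass from the chart chosen at `b'` to the one chosen at `b`, in which the coordinate has not
    -- changed.
    rw [← frame_mul hr (hκ (ind b') (ind b) b' (hind b') hb'W), hx]
    simp only [frame, Equiv.trans_apply, ← hβtr]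
  show LiftsTo p β _ (frame hp c κ r (ind b') b' x.coord e : E)
  rw [h]
  exact liftsTo_transport hp β _

end Retraction

section Retraction

open CocycleCover

variable {ι : Type u} {E B : Type u} [TopologicalSpace E] [TopologicalSpace B]
  [LocallyPathConnectedSpace B] [PathConnectedSpace B]
  {G : Type u} [Group G] [TopologicalSpace G] [DiscreteTopology G] {W : ι → Set B} {p : C(E, B)}

/-- The holonomy homomorphism is, up to an inner automorphism, split by `r`. -/
theorem apply_holonomy (hp : IsMaximalDiskHedgehogCovering p) (hW : ∀ i, IsOpen (W i))
    (ind : B → ι) (hind : ∀ b, b ∈ W (ind b)) (t : ι → ι → G)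
    (ht : ∀ i j k, (W i ∩ W j ∩ W k).Nonempty → t i j * t j k = t i k) (b₀ : B)
    (c : ι → B) (κ : ∀ x y : B, Path x y) (r : G →* MonodromyGroup p hp.isArcCovering b₀)
    (hr : ∀ i j, r (t i j) = MonodromyGroup.mk hp.isArcCovering
      (((κ b₀ (c i)).trans (κ (c i) (c j))).trans (κ b₀ (c j)).symm))
    (hκ : ∀ i j b, b ∈ W i → b ∈ W j →
      (transport hp.isArcCovering (κ (c i) (c j))).trans (transport hp.isArcCovering (κ (c j) b)) =
        transport hp.isArcCovering (κ (c i) b))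
    (hκ' : ∀ i b, b ∈ W i → ∃ U, IsOpen U ∧ b ∈ U ∧ ∀ b' (β : Path b b'), (∀ s, β s ∈ U) →
      b' ∈ W i ∧ (transport hp.isArcCovering (κ (c i) b)).trans (transport hp.isArcCovering β) =
        transport hp.isArcCovering (κ (c i) b')) :
    ∃ k, ∀ a, r (holonomy hp hW ind hind t ht b₀ a) = k * a * k⁻¹ := by
  -- The conjugating loop is the frame at `b₀` with coordinate `1`; the chosen paths out and back
  -- need not cancel.
  refine ⟨MonodromyGroup.mk _ ((κ b₀ (c (ind b₀))).trans (κ (c (ind b₀)) b₀)), fun a => ?_⟩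
  rw [eq_mul_inv_iff_mul_eq]
  refine MonodromyGroup.act_injective ?_
  ext1 e
  obtain ⟨α, rfl⟩ := MonodromyGroup.exists_mk a
  obtain ⟨f, hf⟩ := exists_map_cocycleCover (hW := hW) (hind := hind) (ht := ht) hr hκ hκ'
    hp.isDiskHedgehogCovering.exists_isOpen e
  have h := transport_map (isArcCovering_cocycleProj hW ind hind t ht) hp.isArcCovering f
    (fun x => by rw [hf]; exact (frame hp.isArcCovering c κ r _ _ _ e).2) α ⟨mk b₀ 1, rfl⟩
  rw [transport_cocycleProj, one_mul] at h
  have h' : transport hp.isArcCovering α (frame hp.isArcCovering c κ r (ind b₀) b₀ 1 e) =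
      frame hp.isArcCovering c κ r (ind b₀) b₀ (loopHolonomy hW ind hind t ht b₀ α) e := by
    refine Eq.trans ?_ (h.trans ?_)
    · exact congrArg _ (Subtype.ext (hf (mk b₀ 1)).symm)
    · exact Subtype.ext (hf _)
  simp only [frame, map_one, MonodromyGroup.act_one, Equiv.trans_apply, Equiv.refl_apply] at h'
  simp only [MonodromyGroup.act_mul, holonomy_mk, MonodromyGroup.act_mk, transport_trans,
    Equiv.trans_apply, h']

end Retraction

/-! ### Retracts of finitely presented groups and the group of a cover. -/

section FinitelyPresented

/-- Making each generator of `G` equal to its image under `s ∘ r` adds finitely many relations, and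
they already generate the kernel of `r` as a normal subgroup. -/
theorem isFinitelyPresented_of_retract {G H : Type*} [Group G] [Group H]
    [hG : Group.IsFinitelyPresented G] (r : G →* H) (s : H →* G) (hrs : ∀ h, r (s h) = h) :
    Group.IsFinitelyPresented H := by
  refine Group.IsFinitelyPresented.of_surjective r (fun h => ⟨s h, hrs h⟩) ?_
  obtain ⟨n, φ, hφ, -⟩ := hG.out
  let R : Set G := range fun i : Fin n => φ (FreeGroup.of i) * (s (r (φ (FreeGroup.of i))))⁻¹
  refine ⟨R, finite_range _, le_antisymm (Subgroup.normalClosure_le_normal ?_) fun x hx => ?_⟩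
  · rintro _ ⟨i, rfl⟩
    simp [MonoidHom.mem_ker, hrs]
  · let q := QuotientGroup.mk' (Subgroup.normalClosure R)
    -- Modulo `R`, the identity and `s ∘ r` agree on generators, hence everywhere, so elements
    -- killed by `r` become trivial.
    have h : q.comp φ = (q.comp (s.comp r)).comp φ := by
      ext i
      have : q (φ (FreeGroup.of i) * (s (r (φ (FreeGroup.of i))))⁻¹) = 1 :=
        (QuotientGroup.eq_one_iff _).2 (Subgroup.subset_normalClosure ⟨i, rfl⟩)
      rw [map_mul, map_inv, mul_inv_eq_one] at this
      exact this
    obtain ⟨y, rfl⟩ := hφ x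
    have hy := DFunLike.congr_fun h y
    simp only [MonoidHom.comp_apply, MonoidHom.mem_ker.1 hx, map_one] at hy
    exact (QuotientGroup.eq_one_iff _).1 hy

theorem isFinitelyPresented_of_retract_up_to_conj {G H : Type*} [Group G] [Group H]
    [Group.IsFinitelyPresented G] (r : G →* H) (s : H →* G) (k : H)
    (hrs : ∀ h, r (s h) = k * h * k⁻¹) : Group.IsFinitelyPresented H :=
  isFinitelyPresented_of_retract ((MulAut.conj k⁻¹).toMonoidHom.comp r) s fun h => by
    simp [hrs, mul_assoc]

variable {ι B : Type*} (W : ι → Set B)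

/-- The relations `t i j * t j k = t i k` for all triples of sets of a cover with a common point. -/
def nerveRels : Set (FreeGroup (ι × ι)) :=
  (fun x : ι × ι × ι => FreeGroup.of (x.1, x.2.1) * FreeGroup.of (x.2.1, x.2.2) *
    (FreeGroup.of (x.1, x.2.2))⁻¹) '' {x | (W x.1 ∩ W x.2.1 ∩ W x.2.2).Nonempty}

theorem finite_nerveRels [Finite ι] : (nerveRels W).Finite := (toFinite _).image _

theorem nerve_of_mul_of {i j k : ι} (h : (W i ∩ W j ∩ W k).Nonempty) :
    (PresentedGroup.of (i, j) * PresentedGroup.of (j, k) : PresentedGroup (nerveRels W)) =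
      PresentedGroup.of (i, k) :=
  PresentedGroup.mk_eq_mk_of_mul_inv_mem ⟨(i, j, k), h, rfl⟩

end FinitelyPresented

/-! ### Uniform estimates on a compact metric space. -/

section Uniform

variable {B : Type u} [MetricSpace B] [CompactSpace B] [LocallyPathConnectedSpace B]

theorem exists_pos_forall_path (r : ℝ) (hr : 0 < r) : ∃ δ > 0, ∀ x y : B, dist x y < δ →
    ∃ γ : Path x y, ∀ t, γ t ∈ Metric.ball x r := by
  obtain ⟨δ, hδ, h⟩ := lebesgue_number_lemma_of_metric (isCompact_univ (X := B))
    (c := fun b : B => pathComponentIn (Metric.ball b (r / 2)) b)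
    (fun b => Metric.isOpen_ball.pathComponentIn b)
    (fun b _ => mem_iUnion.2 ⟨b, mem_pathComponentIn_self (Metric.mem_ball_self (half_pos hr))⟩)
  refine ⟨δ, hδ, fun x y hxy => ?_⟩
  obtain ⟨b, hb⟩ := h x trivial
  have hx : JoinedIn (Metric.ball b (r / 2)) b x := hb (Metric.mem_ball_self hδ)
  have hy : JoinedIn (Metric.ball b (r / 2)) b y := hb (Metric.mem_ball'.2 hxy)
  obtain ⟨γ, hγ⟩ := hx.symm.trans hy
  refine ⟨γ, fun t => ?_⟩
  have h1 := Metric.mem_ball.1 (hγ t)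
  have h2 := Metric.mem_ball'.1 hx.target_mem
  exact Metric.mem_ball.2 (by linarith [dist_triangle (γ t) b x])

theorem IsMaximalDiskHedgehogCovering.exists_pos_transport_eq_refl {E : Type u}
    [TopologicalSpace E] {p : C(E, B)} (hp : IsMaximalDiskHedgehogCovering p)
    (hcount : ∀ b, Countable {e // p e = b}) :
    ∃ δ > 0, ∀ (x b : B) (γ : Path b b), (∀ t, γ t ∈ Metric.ball x δ) →
      transport hp.isArcCovering γ = Equiv.refl _ := by
  choose U hU hbU h using fun b => hp.exists_isOpen_transport_eq_refl b
  obtain ⟨δ, hδ, hball⟩ := lebesgue_number_lemma_of_metric (isCompact_univ (X := B))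
    (c := fun b : B => pathComponentIn (U b) b) (fun b => (hU b).pathComponentIn b)
    (fun b _ => mem_iUnion.2 ⟨b, mem_pathComponentIn_self (hbU b)⟩)
  refine ⟨δ, hδ, fun x b γ hγ => ?_⟩
  obtain ⟨y, hy⟩ := hball x trivial
  have hb : JoinedIn (U y) y b := by
    have h0 := hy (hγ 0)
    rwa [γ.source] at h0
  obtain ⟨τ, hτ⟩ := hb
  -- The cover consists of path-components, so the loop can be conjugated to a loop at `y` without
  -- leaving `U y`.
  have key := h y ((τ.trans γ).trans τ.symm) fun t => by
    have hmem : range ((τ.trans γ).trans τ.symm) ⊆ U y := by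
      rw [Path.trans_range, Path.trans_range, Path.symm_range]
      exact union_subset (union_subset (range_subset_iff.2 hτ)
        (range_subset_iff.2 fun t => pathComponentIn_subset (hy (hγ t)))) (range_subset_iff.2 hτ)
    exact hmem ⟨t, rfl⟩
  rw [transport_trans, transport_trans, transport_symm] at key
  ext1 e
  have := DFunLike.congr_fun key ((transport hp.isArcCovering τ).symm e)
  simpa using this

end Uniform

/-- The boundary of the triangle is a loop in `V`, so it acts trivially. -/
theorem transport_trans_eq_of_mem {E B : Type*} [TopologicalSpace E] [TopologicalSpace B]
    {p : C(E, B)} (hp : IsArcCovering p) {V : Set B}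
    (hV : ∀ b (γ : Path b b), (∀ t, γ t ∈ V) → transport hp γ = Equiv.refl _) {x y z : B}
    {α : Path x y} {β : Path y z} {γ : Path x z} (hα : ∀ t, α t ∈ V) (hβ : ∀ t, β t ∈ V)
    (hγ : ∀ t, γ t ∈ V) : (transport hp α).trans (transport hp β) = transport hp γ := by
  have key := hV x ((α.trans β).trans γ.symm) fun t => by
    have hmem : range ((α.trans β).trans γ.symm) ⊆ V := by
      rw [Path.trans_range, Path.trans_range, Path.symm_range]
      exact union_subset (union_subset (range_subset_iff.2 hα) (range_subset_iff.2 hβ))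
        (range_subset_iff.2 hγ)
    exact hmem ⟨t, rfl⟩
  rw [transport_trans, transport_trans, transport_symm] at key
  ext1 e
  have := DFunLike.congr_fun key e
  simpa [Equiv.symm_apply_eq] using this

/-- A countable monodromy group of the maximal disk-hedgehog covering of a Peano continuum is
finitely presented. -/
theorem IsMaximalDiskHedgehogCovering.isFinitelyPresented {E B : Type u} [TopologicalSpace E]
    [MetricSpace B] [CompactSpace B] [PathConnectedSpace B] [LocallyPathConnectedSpace B]
    {p : C(E, B)} (hp : IsMaximalDiskHedgehogCovering p) (b₀ : B)
    [Countable (MonodromyGroup p hp.isArcCovering b₀)] :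
    Group.IsFinitelyPresented (MonodromyGroup p hp.isArcCovering b₀) := by
  classical
  obtain ⟨δ, hδ, hloop⟩ := hp.exists_pos_transport_eq_refl (hp.countable_fiber b₀)
  obtain ⟨η, hη, hpath⟩ := exists_pos_forall_path (B := B) (δ / 3) (by positivity)
  -- A path `κ x y` with `x` and `y` closer than `ε` stays within `δ / 3` of `x`. If `x` is within
  -- `ε ≤ δ / 3` of `w`, it therefore stays in the `δ`-ball of `w`.
  set ε := min η (δ / 3) with hε
  have hε0 : 0 < ε := by positivity
  have hεη : ε ≤ η := min_le_left _ _
  have hεδ : ε ≤ δ / 3 := min_le_right _ _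
  have hκ : ∀ x y : B, ∃ γ : Path x y, dist x y < ε → ∀ t, γ t ∈ Metric.ball x (δ / 3) := by
    intro x y
    by_cases h : dist x y < ε
    · obtain ⟨γ, hγ⟩ := hpath x y (h.trans_le hεη)
      exact ⟨γ, fun _ => hγ⟩
    · exact ⟨PathConnectedSpace.somePath x y, fun h' => absurd h' h⟩
  choose κ hκ using hκ
  have hκball : ∀ w x y : B, dist x w < ε → dist x y < ε → ∀ t, κ x y t ∈ Metric.ball w δ := by
    intro w x y hxw hxy t
    have h1 := Metric.mem_ball.1 (hκ x y hxy t)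
    exact Metric.mem_ball.2 (by linarith [dist_triangle (κ x y t) x w])
  have hκtr : ∀ x y z : B, dist x y < ε → dist y z < ε → dist x z < ε →
      (transport hp.isArcCovering (κ x y)).trans (transport hp.isArcCovering (κ y z)) =
        transport hp.isArcCovering (κ x z) := fun x y z hxy hyz hxz =>
    transport_trans_eq_of_mem hp.isArcCovering (hloop y) (hκball y x y hxy hxy)
      (hκball y y z (by simpa using hε0) hyz) (hκball y x z hxy hxz)
  obtain ⟨T, -, hTfin, hT⟩ := finite_cover_balls_of_compact (isCompact_univ (X := B))
    (half_pos hε0)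
  have : Finite T := hTfin
  -- The radius `ε / 2` puts the centres of intersecting balls at distance less than `ε`.
  let W : T → Set B := fun i => Metric.ball i (ε / 2)
  have hcov : ∀ b, ∃ i : T, b ∈ W i := fun b => by
    obtain ⟨x, hx, hbx⟩ := mem_iUnion₂.1 (hT (mem_univ b))
    exact ⟨⟨x, hx⟩, hbx⟩
  choose ind hind using hcov
  have hdist : ∀ (i j : T) b, b ∈ W i → b ∈ W j → dist (i : B) j < ε := fun i j b hi hj => by
    linarith [dist_triangle (i : B) b j, Metric.mem_ball'.1 hi, Metric.mem_ball.1 hj]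
  have hdist' : ∀ (i : T) b, b ∈ W i → dist (i : B) b < ε := fun i b hi => by
    linarith [Metric.mem_ball'.1 hi]
  let ρ : T × T → MonodromyGroup p hp.isArcCovering b₀ := fun x => MonodromyGroup.mk _
    (((κ b₀ x.1).trans (κ x.1 x.2)).trans (κ b₀ x.2).symm)
  -- The connections to `b₀` cancel, and the triangle of the three centres acts trivially because
  -- they are pairwise closer than `ε`.
  have hρ : ∀ x ∈ nerveRels W, FreeGroup.lift ρ x = 1 := by
    rintro _ ⟨⟨i, j, k⟩, ⟨b, ⟨hi, hj⟩, hk⟩, rfl⟩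
    rw [map_mul, map_mul, map_inv, mul_inv_eq_one]
    simp only [FreeGroup.lift_apply_of]
    refine MonodromyGroup.act_injective ?_
    ext1 e
    simp only [ρ, MonodromyGroup.act_mul, MonodromyGroup.act_mk, transport_trans, transport_symm,
      Equiv.trans_apply, Equiv.apply_symm_apply,
      ← hκtr i j k (hdist i j b hi hj) (hdist j k b hj hk) (hdist i k b hi hk)]
  let _ : TopologicalSpace (PresentedGroup (nerveRels W)) := ⊥
  have : DiscreteTopology (PresentedGroup (nerveRels W)) := ⟨rfl⟩
  have hW : ∀ i, IsOpen (W i) := fun i => Metric.isOpen_ball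
  obtain ⟨k, hk⟩ := apply_holonomy hp hW ind hind
    (fun i j => (PresentedGroup.of (i, j) : PresentedGroup (nerveRels W)))
    (fun i j k h => nerve_of_mul_of W h) b₀ (fun i => (i : B)) κ (PresentedGroup.toGroup hρ)
    (fun i j => PresentedGroup.toGroup.of hρ)
    (fun i j b hi hj => hκtr i j b (hdist i j b hi hj) (hdist' j b hj) (hdist' i b hi))
    (fun i b hi => ⟨W i, hW i, hi, fun b' β hβ => by
      have hb' : b' ∈ W i := by simpa using hβ 1
      refine ⟨hb', transport_trans_eq_of_mem hp.isArcCovering (hloop i)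
        (hκball i i b (by simpa using hε0) (hdist' i b hi)) (fun t => ?_)
        (hκball i i b' (by simpa using hε0) (hdist' i b' hb'))⟩
      exact Metric.ball_subset_ball (by linarith) (hβ t)⟩)
  have : Finite (nerveRels W) := finite_nerveRels W
  exact isFinitelyPresented_of_retract_up_to_conj _ _ k hk

end Hedgehog

theorem mainTheorem6 (B : Type*) [TopologicalSpace B] [CompactSpace B]
    [TopologicalSpace.MetrizableSpace B] [ConnectedSpace B] [LocallyPathConnectedSpace B]
    (b₀ : B) (hcount : Countable (Hedgehog.HedgehogFundamentalGroup b₀)) :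
    Group.IsFinitelyPresented (Hedgehog.HedgehogFundamentalGroup b₀) := by
  let _ := TopologicalSpace.metrizableSpaceMetric B
  exact (Hedgehog.isMaximalDiskHedgehogCovering_maximalCovering B).isFinitelyPresented b₀
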